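/- Let $\rho$ be a density matrix on a finite-dimensional complex Hilbert space (that is, $\rho\ge 0$ and $\operatorname{tr}\rho=1$), and let $\sigma\ge 0$ be a positive semidefinite matrix on the same space with $\operatorname{supp}\rho\subseteq\operatorname{supp}\sigma$. Powers and logarithms of positive semidefinite matrices are taken on the support. Let $S(\rho\|\sigma)=\operatorname{tr}(\rho\ln\rho)-\operatorname{tr}(\rho\ln\sigma)$, and for $\alpha\in(0,1)\cup(1,\infty)$ let $$S_\alpha(\rho\|\sigma)=\frac{1}{\alpha-1}\ln\operatorname{tr}\bigl(\rho^{\alpha}\sigma^{1-\alpha}\bigr),\qquad \underline{S}_\alpha(\rho\|\sigma)=\frac{1}{\alpha-1}\ln\operatorname{tr}\Bigl[\bigl(\sigma^{\frac{1-\alpha}{2\alpha}}\rho\,\sigma^{\frac{1-\alpha}{2\alpha}}\bigr)^{\alpha}\Bigr],$$ where for $\alpha=0,1,\infty$ both quantities are understood as the corresponding limits; $S_\alpha'$ and $\underline{S}_\alpha'$ denote derivatives with respect to $\alpha$. Let $\Pi_\rho$ be the orthogonal projector onto $\operatorname{supp}\rho$. Then the following conditions are equivalent: 1. $S_\alpha(\rho\|\sigma)=S(\rho\|\sigma)$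 for all $\alpha\in[0,\infty]$; 2. $S_\alpha(\rho\|\sigma)=S(\rho\|\sigma)$ for some $\alpha\in[0,\infty]$ with $\alpha\neq1$; 3. $\lim_{\alpha\to1}S_\alpha'(\rho\|\sigma)=0$; 4. $\underline{S}_\alpha(\rho\|\sigma)=S(\rho\|\sigma)$ for all $\alpha\in[0,\infty]$; 5. $\underline{S}_\alpha(\rho\|\sigma)=S(\rho\|\sigma)$ for some $\alpha\in[0,\infty]$ with $\alpha\neq1$; 6. $\lim_{\alpha\to1}\underline{S}_\alpha'(\rho\|\sigma)=0$; 7. $\rho$ commutes with $\sigma$ and is proportional to $\Pi_\rho\sigma$. -/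

import Mathlib

open Filter Topology
open scoped ENNReal ComplexOrder

noncomputable section

namespace QRenyi

variable {n : Type*} [Fintype n] [DecidableEq n]

/-- A density matrix: positive semidefinite with unit trace. -/
def IsDensityMatrix (ρ : Matrix n n ℂ) : Prop :=
  ρ.PosSemidef ∧ ρ.trace = 1

/-- The support of a positive (more generally Hermitian) matrix: its range, which is the
orthogonal complement of its kernel. -/
def supp (A : Matrix n n ℂ) : Submodule ℂ (EuclideanSpace ℂ n) :=
  LinearMap.range (Matrix.toEuclideanLin A)

/-- The matrix of the orthogonal projector onto the support of `A`. -/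
def suppProj (A : Matrix n n ℂ) : Matrix n n ℂ :=
  Matrix.toEuclideanLin.symm (supp A).starProjection.toLinearMap

/-- The real power `A ^ r` of a positive semidefinite matrix, taken on the support of `A`: in
the spectral decomposition every positive eigenvalue `x` becomes `x ^ r`, and the eigenvalue
`0` stays `0`, whatever the sign of `r`. -/
def suppPow (A : Matrix n n ℂ) (r : ℝ) : Matrix n n ℂ :=
  cfc (fun x : ℝ => if x = 0 then 0 else x ^ r) A

/-- The natural logarithm of a positive semidefinite matrix, taken on its support
(recall that `Real.log 0 = 0`). -/
def suppLog (A : Matrix n n ℂ) : Matrix n n ℂ :=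
  cfc Real.log A

/-- The relative entropy `S(ρ‖σ) = tr(ρ ln ρ) - tr(ρ ln σ)`, for `supp ρ ≤ supp σ`.
All traces occurring here and below are real, so that taking real parts loses nothing. -/
def relEntropy (ρ σ : Matrix n n ℂ) : ℝ :=
  (ρ * suppLog ρ).trace.re - (ρ * suppLog σ).trace.re

/-- The formula `(α - 1)⁻¹ ln tr(ρ ^ α σ ^ (1 - α))`, for real `α > 0`, `α ≠ 1`. -/
def renyiFormula (ρ σ : Matrix n n ℂ) (α : ℝ) : ℝ :=
  1 / (α - 1) * Real.log (suppPow ρ α * suppPow σ (1 - α)).trace.re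

/-- The formula `(α - 1)⁻¹ ln tr((σ ^ ((1 - α) / 2α) ρ σ ^ ((1 - α) / 2α)) ^ α)`,
for real `α > 0`, `α ≠ 1`. -/
def sandwichedFormula (ρ σ : Matrix n n ℂ) (α : ℝ) : ℝ :=
  1 / (α - 1) * Real.log
    (suppPow (suppPow σ ((1 - α) / (2 * α)) * ρ * suppPow σ ((1 - α) / (2 * α))) α).trace.re

/-- For a function `f` given by a formula at the orders in `(0, 1) ∪ (1, ∞)`, the statement that
its value at the order `α ∈ [0, ∞]` is `v`. At `α = 0, 1, ∞` the value is understood as the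
limit of `f`, and the statement then says that this limit exists and is `v`. -/
def HasValueAtOrder (f : ℝ → ℝ) (α : ℝ≥0∞) (v : ℝ) : Prop :=
  if α = 0 then Tendsto f (𝓝[>] 0) (𝓝 v)
  else if α = 1 then Tendsto f (𝓝[≠] 1) (𝓝 v)
  else if α = ⊤ then Tendsto f atTop (𝓝 v)
  else f α.toReal = v

/-- `S_α(ρ‖σ) = v`, for `α ∈ [0, ∞]`. -/
def RenyiEq (ρ σ : Matrix n n ℂ) (α : ℝ≥0∞) (v : ℝ) : Prop :=
  HasValueAtOrder (renyiFormula ρ σ) α v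

/-- `S̲_α(ρ‖σ) = v` (the sandwiched version), for `α ∈ [0, ∞]`. -/
def SandwichedEq (ρ σ : Matrix n n ℂ) (α : ℝ≥0∞) (v : ℝ) : Prop :=
  HasValueAtOrder (sandwichedFormula ρ σ) α v

/-- The derivative of `f` exists near (but not necessarily at) `1`, and it tends to `l` at `1`. -/
def DerivTendstoAtOne (f : ℝ → ℝ) (l : ℝ) : Prop :=
  (∀ᶠ α in 𝓝[≠] (1 : ℝ), DifferentiableAt ℝ f α) ∧ Tendsto (deriv f) (𝓝[≠] 1) (𝓝 l)

end QRenyi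

end

noncomputable section

namespace QRenyi

variable {n : Type*} [Fintype n] [DecidableEq n]

/-! Let `p i`, `e i` and `q j`, `f j` be the eigenvalues and eigenvectors of `ρ` and `σ`. The
numbers `P (i, j) = p i * |⟨e i, f j⟩|²` form a probability distribution. For the random variable `X
= ln p i - ln q j`, the trace of `ρ ^ α σ ^ (1 - α)` is the exponential moment `E exp ((α - 1) X)`,
and the relative entropy `S` is the mean `E X` (`trace_suppPow_mul_suppPow`, `relEntropy_eq`).
Condition 7 says exactly that `X` is constant where `P` is nonzero (`scale_of_X_eq`, `Scale.X_eq`).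
It makes both families constant in `α`, so the work lies in deriving it from each of the other
conditions.

For `S_α` this is the equality case of Jensen's inequality. At order `∞` the mean of `X` reaches its
maximum. If the derivative tends to zero at `1`, a quadratic lower bound on the exponential moment
forces the variance of `X` to vanish (`DerivTendstoAtOne.coeff_nonpos`).

The sandwiched trace equals `tr (ρ ^ (1 / 2) σ ^ s ρ ^ (1 / 2)) ^ α` with `s = (1 - α) / α`. For `α
> 1`, Peierls' inequality in the eigenbasis of `ρ`, followed by Jensen over `f` and over `e`, bounds
it below by `exp ((α - 1) S)`; equality in both uses of Jensen makes `X` constant (`X_eq_of_L`). The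
same bound handles `∞` and, with variances kept, the derivative. The latter also needs the limit `S`
at `1` from the right (`tendsto_sandwichedFormula`).

For `0 < α < 1` Peierls' inequality for the power points the other way. The trace is instead written
as an expectation in the eigenbasis of `ρ ^ (1 / 2) σ ^ s ρ ^ (1 / 2)`, and the bound follows from
`sum_log_le_sum_weight_log_lam` together with Peierls for `x log x`. The logarithmic inequality
comes from a variational bound for the functions `x / (x + u)`. Equality makes this basis
diagonalise `ρ` as well, which reduces to the previous situation. At order `0`, comparing `ρ` with a
multiple of its support projection gives `E exp (-X) ≤ exp (-S)`, again an equality case of Jensen.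
-/

/-! ### Matrices as operators, eigenbases and functional calculus. -/

/-- The linear operator on Euclidean space given by a square matrix. -/
def op (A : Matrix n n ℂ) : EuclideanSpace ℂ n →ₗ[ℂ] EuclideanSpace ℂ n :=
  Matrix.toEuclideanLin A

lemma op_mul (A B : Matrix n n ℂ) (x : EuclideanSpace ℂ n) : op (A * B) x = op A (op B x) := by
  unfold op
  rw [Matrix.toLpLin_mul_same]
  rfl

lemma op_smul (c : ℝ) (A : Matrix n n ℂ) (x : EuclideanSpace ℂ n) :
    op (c • A) x = (c : ℂ) • op A x := by
  have : c • A = (c : ℂ) • A := by ext i j; simp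
  rw [this]
  unfold op
  rw [map_smul]
  rfl

lemma op_injective : Function.Injective (op (n := n)) := Matrix.toEuclideanLin.injective

lemma ext_of_basis {A B : Matrix n n ℂ} (b : OrthonormalBasis n ℂ (EuclideanSpace ℂ n))
    (h : ∀ i, op A (b i) = op B (b i)) : A = B := by
  apply op_injective
  apply b.toBasis.ext
  intro i
  simpa using h i

lemma inner_op_left {A : Matrix n n ℂ} (hA : A.IsHermitian) (x y : EuclideanSpace ℂ n) :
    inner ℂ (op A x) y = inner ℂ x (op A y) :=
  Matrix.isSymmetric_toEuclideanLin_iff.mpr hA x y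

lemma trace_eq_sum_inner_op (A : Matrix n n ℂ) (b : OrthonormalBasis n ℂ (EuclideanSpace ℂ n)) :
    A.trace = ∑ i, inner ℂ (b i) (op A (b i)) := by
  rw [← LinearMap.trace_eq_sum_inner]
  unfold op
  rw [Matrix.toEuclideanLin_eq_toLin_orthonormal, Matrix.trace_toLin_eq]

/-- The orthonormal basis `b` consists of eigenvectors of `A`, with real eigenvalues `a`. -/
def IsEigenbasis (A : Matrix n n ℂ) (b : OrthonormalBasis n ℂ (EuclideanSpace ℂ n))
    (a : n → ℝ) : Prop :=
  ∀ i, op A (b i) = (a i : ℂ) • b i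

lemma isEigenbasis_eigenvectorBasis {A : Matrix n n ℂ} (hA : A.IsHermitian) :
    IsEigenbasis A hA.eigenvectorBasis hA.eigenvalues := by
  intro i
  have := hA.mulVec_eigenvectorBasis i
  unfold op
  ext k
  have h2 := congrFun this k
  simpa [Matrix.toLpLin_apply] using h2

namespace IsEigenbasis

variable {A B : Matrix n n ℂ} {b f : OrthonormalBasis n ℂ (EuclideanSpace ℂ n)} {a c : n → ℝ}

lemma op_apply (h : IsEigenbasis A b a) (x : EuclideanSpace ℂ n) :
    op A x = ∑ i, ((a i : ℂ) * inner ℂ (b i) x) • b i := by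
  conv_lhs => rw [← b.sum_repr' x]
  rw [map_sum]
  refine Finset.sum_congr rfl fun i _ => ?_
  rw [map_smul, h i, smul_smul, mul_comm]

lemma inner_op (h : IsEigenbasis A b a) (x y : EuclideanSpace ℂ n) :
    inner ℂ x (op A y) = ∑ i, (a i : ℂ) * (inner ℂ x (b i) * inner ℂ (b i) y) := by
  rw [h.op_apply, inner_sum]
  refine Finset.sum_congr rfl fun i _ => ?_
  rw [inner_smul_right]
  ring

lemma inner_basis_op (h : IsEigenbasis A b a) (i : n) (y : EuclideanSpace ℂ n) :
    inner ℂ (b i) (op A y) = (a i : ℂ) * inner ℂ (b i) y := by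
  rw [h.op_apply, b.orthonormal.inner_right_fintype]

lemma inner_op_self (h : IsEigenbasis A b a) (x : EuclideanSpace ℂ n) :
    inner ℂ x (op A x) = ((∑ i, a i * ‖(inner ℂ (b i) x : ℂ)‖ ^ 2 : ℝ) : ℂ) := by
  rw [h.inner_op]
  push_cast
  refine Finset.sum_congr rfl fun i _ => ?_
  rw [← inner_conj_symm x (b i), Complex.conj_mul']

lemma re_inner_op_self (h : IsEigenbasis A b a) (x : EuclideanSpace ℂ n) :
    (inner ℂ x (op A x) : ℂ).re = ∑ i, a i * ‖(inner ℂ (b i) x : ℂ)‖ ^ 2 := by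
  rw [h.inner_op_self, Complex.ofReal_re]

lemma trace_eq (h : IsEigenbasis A b a) : A.trace = ((∑ i, a i : ℝ) : ℂ) := by
  rw [trace_eq_sum_inner_op A b]
  push_cast
  refine Finset.sum_congr rfl fun i _ => ?_
  rw [h i, inner_smul_right, inner_self_eq_norm_sq_to_K, b.orthonormal.1 i]
  simp

lemma trace_re (h : IsEigenbasis A b a) : A.trace.re = ∑ i, a i := by
  rw [h.trace_eq, Complex.ofReal_re]

lemma trace_mul_re (h : IsEigenbasis A b a) (h' : IsEigenbasis B f c) :
    (A * B).trace.re = ∑ i, ∑ j, a i * c j * ‖(inner ℂ (b i) (f j) : ℂ)‖ ^ 2 := by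
  rw [trace_eq_sum_inner_op _ b, Complex.re_sum]
  refine Finset.sum_congr rfl fun i _ => ?_
  rw [op_mul, h.inner_basis_op, Complex.re_ofReal_mul, h'.re_inner_op_self, Finset.mul_sum]
  refine Finset.sum_congr rfl fun j _ => ?_
  rw [norm_inner_symm]
  ring

lemma isHermitian (h : IsEigenbasis A b a) : A.IsHermitian := by
  apply Matrix.isSymmetric_toEuclideanLin_iff.mp
  intro x y
  change inner ℂ (op A x) y = inner ℂ x (op A y)
  rw [← inner_conj_symm, h.inner_op, h.inner_op, map_sum]
  refine Finset.sum_congr rfl fun i _ => ?_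
  simp only [map_mul, inner_conj_symm, Complex.conj_ofReal]
  ring

end IsEigenbasis

lemma isHermitian_cfc {A : Matrix n n ℂ} (φ : ℝ → ℝ) : (cfc φ A).IsHermitian :=
  cfc_predicate φ A

lemma isEigenbasis_cfc_eigenvectorBasis {A : Matrix n n ℂ} (hA : A.IsHermitian) (φ : ℝ → ℝ) :
    IsEigenbasis (cfc φ A) hA.eigenvectorBasis (fun i => φ (hA.eigenvalues i)) := by
  intro i
  have hU : op (star (hA.eigenvectorUnitary : Matrix n n ℂ)) (hA.eigenvectorBasis i)
      = EuclideanSpace.single i 1 := by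
    have := hA.star_eigenvectorUnitary_mulVec i
    unfold op
    ext k
    simpa [Matrix.toLpLin_apply, Pi.single_apply] using congrFun this k
  have hU' : op (hA.eigenvectorUnitary : Matrix n n ℂ) (EuclideanSpace.single i 1)
      = hA.eigenvectorBasis i := by
    unfold op
    ext k
    simp [Matrix.toLpLin_apply]
  have hD : op (Matrix.diagonal (RCLike.ofReal ∘ φ ∘ hA.eigenvalues) : Matrix n n ℂ)
      (EuclideanSpace.single i 1) = (φ (hA.eigenvalues i) : ℂ) • EuclideanSpace.single i 1 := by
    unfold op
    ext k
    by_cases hk : k = i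
    · subst hk; simp [Matrix.toLpLin_apply]
    · simp [Matrix.toLpLin_apply, hk]
  rw [hA.cfc_eq, Matrix.IsHermitian.cfc, Unitary.conjStarAlgAut_apply, op_mul, op_mul, hU, hD,
    map_smul, hU']

/-- The functional calculus acts on every eigenvector, not only those of a chosen basis. -/
lemma op_cfc_of_op_eq_smul {A : Matrix n n ℂ} (hA : A.IsHermitian) (φ : ℝ → ℝ)
    {x : EuclideanSpace ℂ n} {a : ℝ} (hx : op A x = (a : ℂ) • x) :
    op (cfc φ A) x = (φ a : ℂ) • x := by
  rw [(isEigenbasis_cfc_eigenvectorBasis hA φ).op_apply]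
  conv_rhs => rw [← hA.eigenvectorBasis.sum_repr' x, Finset.smul_sum]
  refine Finset.sum_congr rfl fun i _ => ?_
  rw [smul_smul]
  by_cases h0 : (inner ℂ (hA.eigenvectorBasis i) x : ℂ) = 0
  · simp [h0]
  · have h1 := (isEigenbasis_eigenvectorBasis hA).inner_basis_op i x
    rw [hx, inner_smul_right] at h1
    have h2 := mul_right_cancel₀ h0 h1
    rw [Complex.ofReal_inj] at h2
    rw [h2]

lemma IsEigenbasis.cfc {A : Matrix n n ℂ} {b : OrthonormalBasis n ℂ (EuclideanSpace ℂ n)}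
    {a : n → ℝ} (h : IsEigenbasis A b a) (φ : ℝ → ℝ) :
    IsEigenbasis (cfc φ A) b (fun i => φ (a i)) :=
  fun i => op_cfc_of_op_eq_smul h.isHermitian φ (h i)

lemma IsEigenbasis.mul {A B : Matrix n n ℂ} {b : OrthonormalBasis n ℂ (EuclideanSpace ℂ n)}
    {a c : n → ℝ} (h : IsEigenbasis A b a) (h' : IsEigenbasis B b c) :
    IsEigenbasis (A * B) b (fun i => a i * c i) := by
  intro i
  rw [op_mul, h' i, map_smul, h i, smul_smul]
  push_cast
  rw [mul_comm]

/-- The trace of a function of a Hermitian matrix only depends on the characteristic polynomial. -/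
lemma trace_cfc_eq_of_charpoly_eq {A B : Matrix n n ℂ} (hA : A.IsHermitian) (hB : B.IsHermitian)
    (h : A.charpoly = B.charpoly) (φ : ℝ → ℝ) :
    (cfc φ A).trace.re = (cfc φ B).trace.re := by
  rw [(isEigenbasis_cfc_eigenvectorBasis hA φ).trace_re,
    (isEigenbasis_cfc_eigenvectorBasis hB φ).trace_re,
    (hA.eigenvalues_eq_eigenvalues_iff hB).mpr h]

/-! ### Jensen's inequality for `exp` and `log`, with equality cases and a second-order form. -/

section Jensen

variable {ι : Type*} [Fintype ι] {w x y : ι → ℝ}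

lemma exp_sum_le_sum_exp (hw : ∀ i, 0 ≤ w i) (h1 : ∑ i, w i = 1) :
    Real.exp (∑ i, w i * x i) ≤ ∑ i, w i * Real.exp (x i) := by
  have := convexOn_exp.map_sum_le (t := Finset.univ) (w := w) (p := x)
    (fun i _ => hw i) h1 (fun i _ => Set.mem_univ _)
  simpa using this

/-- The gap `exp t - t - 1` is nonnegative and vanishes only at `t = 0`. Multiplied by `exp (-μ)`,
the hypothesis says that the mean gap at `t = x i - μ` is at most zero. -/
lemma eq_sum_of_sum_exp_le (hw : ∀ i, 0 ≤ w i) (h1 : ∑ i, w i = 1)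
    (h : ∑ i, w i * Real.exp (x i) ≤ Real.exp (∑ i, w i * x i)) (i : ι) (hi : w i ≠ 0) :
    x i = ∑ i, w i * x i := by
  set μ := ∑ i, w i * x i with hμ
  have hnn : ∀ i, 0 ≤ w i * (Real.exp (x i - μ) - (x i - μ) - 1) := fun i =>
    mul_nonneg (hw i) (by linarith [Real.add_one_le_exp (x i - μ)])
  have hsum : ∑ i, w i * (Real.exp (x i - μ) - (x i - μ) - 1) ≤ 0 := by
    have e1 : ∀ i, w i * (Real.exp (x i - μ) - (x i - μ) - 1)
        = w i * Real.exp (x i) * Real.exp (-μ) - w i * x i + w i * μ - w i := by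
      intro i
      rw [sub_eq_add_neg (x i) μ, Real.exp_add]
      ring
    simp_rw [e1]
    rw [Finset.sum_sub_distrib, Finset.sum_add_distrib, Finset.sum_sub_distrib,
      ← Finset.sum_mul, ← Finset.sum_mul, h1, ← hμ]
    have : (∑ i, w i * Real.exp (x i)) * Real.exp (-μ) ≤ Real.exp μ * Real.exp (-μ) :=
      mul_le_mul_of_nonneg_right h (Real.exp_pos _).le
    rw [← Real.exp_add, add_neg_cancel, Real.exp_zero] at this
    linarith
  have h0 := (Finset.sum_eq_zero_iff_of_nonneg (fun i _ => hnn i)).mp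
    (le_antisymm hsum (Finset.sum_nonneg fun i _ => hnn i)) i (Finset.mem_univ i)
  rcases mul_eq_zero.mp h0 with h0 | h0
  · exact absurd h0 hi
  · by_contra hne
    have := Real.add_one_lt_exp (sub_ne_zero.mpr hne)
    linarith

lemma sum_exp_log (hw : ∀ i, w i ≠ 0 → 0 < y i) :
    ∑ i, w i * Real.exp (Real.log (y i)) = ∑ i, w i * y i := by
  refine Finset.sum_congr rfl fun i _ => ?_
  by_cases hi : w i = 0
  · simp [hi]
  · rw [Real.exp_log (hw i hi)]

lemma sum_pos_of_weights (hw : ∀ i, 0 ≤ w i) (h1 : ∑ i, w i = 1)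
    (hy : ∀ i, w i ≠ 0 → 0 < y i) : 0 < ∑ i, w i * y i := by
  rw [← sum_exp_log hy]
  exact (Real.exp_pos _).trans_le (exp_sum_le_sum_exp hw h1)

lemma sum_log_le_log_sum (hw : ∀ i, 0 ≤ w i) (h1 : ∑ i, w i = 1)
    (hy : ∀ i, w i ≠ 0 → 0 < y i) :
    ∑ i, w i * Real.log (y i) ≤ Real.log (∑ i, w i * y i) := by
  rw [Real.le_log_iff_exp_le (sum_pos_of_weights hw h1 hy), ← sum_exp_log hy]
  exact exp_sum_le_sum_exp hw h1

lemma log_eq_sum_of_log_sum_le (hw : ∀ i, 0 ≤ w i) (h1 : ∑ i, w i = 1)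
    (hy : ∀ i, w i ≠ 0 → 0 < y i)
    (h : Real.log (∑ i, w i * y i) ≤ ∑ i, w i * Real.log (y i)) (i : ι) (hi : w i ≠ 0) :
    Real.log (y i) = ∑ i, w i * Real.log (y i) := by
  apply eq_sum_of_sum_exp_le (x := fun i => Real.log (y i)) hw h1 _ i hi
  rw [sum_exp_log hy]
  exact (Real.log_le_iff_le_exp (sum_pos_of_weights hw h1 hy)).mp h

/-- If all values with positive weight are at most a number that the mean reaches, they are equal
to it. -/
lemma eq_of_le_of_le_sum (hw : ∀ i, 0 ≤ w i) (h1 : ∑ i, w i = 1) {S : ℝ}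
    (hx : ∀ i, w i ≠ 0 → x i ≤ S) (hS : S ≤ ∑ i, w i * x i) (i : ι) (hi : w i ≠ 0) :
    x i = S := by
  have hnn : ∀ i, 0 ≤ w i * (S - x i) := fun i => by
    by_cases h : w i = 0
    · simp [h]
    · exact mul_nonneg (hw i) (by linarith [hx i h])
  have hsum : ∑ i, w i * (S - x i) ≤ 0 := by
    simp_rw [mul_sub]
    rw [Finset.sum_sub_distrib, ← Finset.sum_mul, h1]
    linarith
  have h0 := (Finset.sum_eq_zero_iff_of_nonneg (fun i _ => hnn i)).mp
    (le_antisymm hsum (Finset.sum_nonneg fun i _ => hnn i)) i (Finset.mem_univ i)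
  rcases mul_eq_zero.mp h0 with h0 | h0
  · exact absurd h0 hi
  · linarith

/-- The square of the tangent line bound at `z / 2`, whose left side is nonnegative for `z ≥ -2`. -/
lemma one_add_add_sq_le_exp {z : ℝ} (hz : -2 ≤ z) : 1 + z + z ^ 2 / 4 ≤ Real.exp z := by
  have h1 := Real.add_one_le_exp (z / 2)
  have h2 : Real.exp z = Real.exp (z / 2) ^ 2 := by rw [← Real.exp_nat_mul]; ring_nf
  rw [h2]
  nlinarith

/-- A quantitative Jensen inequality: centring at the mean cancels the linear term, and a quarter of
the variance remains. -/
lemma eventually_one_add_sq_le_sum_exp (hw : ∀ i, 0 ≤ w i) (h1 : ∑ i, w i = 1) :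
    ∀ᶠ s in 𝓝 (0 : ℝ), 1 + s ^ 2 * ((∑ i, w i * (x i - ∑ i, w i * x i) ^ 2) / 4)
      ≤ ∑ i, w i * Real.exp (s * (x i - ∑ i, w i * x i)) := by
  set μ := ∑ i, w i * x i with hμ
  have hev : ∀ᶠ s in 𝓝 (0 : ℝ), ∀ i, -2 < s * (x i - μ) := by
    rw [eventually_all]
    intro i
    have : Tendsto (fun s : ℝ => s * (x i - μ)) (𝓝 0) (𝓝 (0 * (x i - μ))) :=
      (continuous_id.mul continuous_const).tendsto 0
    rw [zero_mul] at this
    exact this.eventually (lt_mem_nhds (by norm_num))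
  filter_upwards [hev] with s hs
  calc 1 + s ^ 2 * ((∑ i, w i * (x i - μ) ^ 2) / 4)
      = ∑ i, w i * (1 + s * (x i - μ) + (s * (x i - μ)) ^ 2 / 4) := by
        have e1 : ∀ i, w i * (1 + s * (x i - μ) + (s * (x i - μ)) ^ 2 / 4)
          = w i + s * (w i * x i) - (s * μ) * w i + s ^ 2 / 4 * (w i * (x i - μ) ^ 2) := by
          intro i; ring
        simp_rw [e1]
        rw [Finset.sum_add_distrib, Finset.sum_sub_distrib, Finset.sum_add_distrib,
          ← Finset.mul_sum, ← Finset.mul_sum, ← Finset.mul_sum, h1, ← hμ]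
        ring
    _ ≤ _ := Finset.sum_le_sum fun i _ =>
        mul_le_mul_of_nonneg_left (one_add_add_sq_le_exp (hs i).le) (hw i)

/-- The mean is the derivative at `0` of the cumulant generating function. -/
lemma tendsto_cumulant_slope (h1 : ∑ i, w i = 1) :
    Tendsto (fun α : ℝ => 1 / (α - 1) * Real.log (∑ i, w i * Real.exp ((α - 1) * x i)))
      (𝓝[≠] 1) (𝓝 (∑ i, w i * x i)) := by
  have hd : HasDerivAt (fun α : ℝ => Real.log (∑ i, w i * Real.exp ((α - 1) * x i)))
      (∑ i, w i * x i) 1 := by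
    have h2 : HasDerivAt (fun α : ℝ => ∑ i, w i * Real.exp ((α - 1) * x i))
        (∑ i, w i * x i) 1 := by
      apply HasDerivAt.fun_sum
      intro i _
      have := ((((hasDerivAt_id (1 : ℝ)).sub_const 1).mul_const (x i)).exp).const_mul (w i)
      simpa using this
    have h3 := h2.log (by simp [h1])
    simpa [h1] using h3
  have := hd.tendsto_slope
  refine this.congr fun α => ?_
  simp [slope_def_field, h1, div_eq_inv_mul]

end Jensen

/-! ### The consequence of a vanishing limit derivative. -/

/-- If `f' → 0` at `1`, then `f` cannot grow linearly from its right limit at `1`. -/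
lemma DerivTendstoAtOne.coeff_nonpos {f : ℝ → ℝ} {S c : ℝ} (hf : DerivTendstoAtOne f 0)
    (hS : Tendsto f (𝓝[>] 1) (𝓝 S))
    (hc : ∀ᶠ α in 𝓝[>] (1 : ℝ), 1 + c * (α - 1) ^ 2 ≤ Real.exp ((α - 1) * (f α - S))) :
    c ≤ 0 := by
  have hle : 𝓝[>] (1 : ℝ) ≤ 𝓝[≠] 1 := nhdsWithin_mono _ fun x hx => ne_of_gt hx
  refine le_of_forall_pos_le_add fun η hη => ?_
  -- The bound `1` keeps the exponent within the range of `|exp z - 1| ≤ 2 |z|`; the bound `η / 2`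
  -- absorbs that factor two.
  set ε := min (η / 2) 1 with hε
  have hε0 : 0 < ε := lt_min (by linarith) one_pos
  have h1 : ∀ᶠ α in 𝓝[>] (1 : ℝ), |deriv f α| < ε := by
    have := (hf.2.mono_left hle).eventually (Metric.ball_mem_nhds 0 hε0)
    filter_upwards [this] with α h
    simpa using h
  obtain ⟨u, hu, hI⟩ := (mem_nhdsGT_iff_exists_Ioo_subset).mp
    ((h1.and (hle hf.1)).and hc)
  have hu1 : (1 : ℝ) < u := hu
  obtain ⟨α, hα1, hα2⟩ := exists_between (lt_min hu1 (by norm_num : (1 : ℝ) < 2))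
  have hαu : α < u := hα2.trans_le (min_le_left _ _)
  have hα3 : α < 2 := hα2.trans_le (min_le_right _ _)
  -- The value `f 1` carries no information, so the mean value inequality is used on `(β, α)`, and
  -- then `β` tends to `1`.
  have hlip : ∀ β ∈ Set.Ioo 1 α, |f α - f β| ≤ ε * (α - 1) := by
    intro β hβ
    have := (convex_Ioo (1 : ℝ) u).norm_image_sub_le_of_norm_deriv_le (f := f) (C := ε)
      (fun z hz => (hI hz).1.2) (fun z hz => by simpa using (hI hz).1.1.le)
      (x := β) (y := α) ⟨hβ.1, hβ.2.trans hαu⟩ ⟨hα1, hαu⟩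
    rw [Real.norm_eq_abs, Real.norm_eq_abs, abs_of_pos (by linarith [hβ.2] : 0 < α - β)] at this
    nlinarith [hβ.1]
  have hlim : |f α - S| ≤ ε * (α - 1) := by
    have ht : Tendsto (fun β => |f α - f β|) (𝓝[>] 1) (𝓝 |f α - S|) :=
      (tendsto_const_nhds.sub hS).abs
    refine le_of_tendsto ht ?_
    filter_upwards [Ioo_mem_nhdsGT hα1] with β hβ using hlip β hβ
  have hc' := (hI ⟨hα1, hαu⟩).2
  set d := α - 1 with hd
  have hd0 : 0 < d := by simp only [hd]; linarith
  have hd1 : d < 1 := by simp only [hd]; linarith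
  have hz : |d * (f α - S)| ≤ ε * d ^ 2 := by
    rw [abs_mul, abs_of_pos hd0]
    nlinarith
  have hε1 : ε ≤ 1 := min_le_right _ _
  have hεη : ε ≤ η / 2 := min_le_left _ _
  have hz1 : |d * (f α - S)| ≤ 1 := hz.trans (by nlinarith)
  have he := (le_abs_self _).trans (Real.abs_exp_sub_one_le hz1)
  have : c * d ^ 2 ≤ η * d ^ 2 := by nlinarith [sq_nonneg d]
  have := le_of_mul_le_mul_right this (by positivity)
  linarith

/-! ### Spectral decompositions of the pair and the joint distribution of eigenvalues. -/

/-- The real power with the convention that `0` is sent to `0`. -/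
def srpow (r x : ℝ) : ℝ := if x = 0 then 0 else x ^ r

lemma suppPow_eq (A : Matrix n n ℂ) (r : ℝ) : suppPow A r = cfc (srpow r) A := rfl

lemma srpow_zero (r : ℝ) : srpow r 0 = 0 := if_pos rfl

lemma srpow_of_pos {x : ℝ} (hx : 0 < x) (r : ℝ) : srpow r x = x ^ r := if_neg hx.ne'

lemma srpow_nonneg {x : ℝ} (hx : 0 ≤ x) (r : ℝ) : 0 ≤ srpow r x := by
  unfold srpow
  split_ifs
  · exact le_rfl
  · exact Real.rpow_nonneg hx r

lemma srpow_pos {x : ℝ} (hx : 0 < x) (r : ℝ) : 0 < srpow r x := by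
  rw [srpow_of_pos hx]
  exact Real.rpow_pos_of_pos hx r

lemma srpow_eq_rpow {x r : ℝ} (hr : 0 < r) : srpow r x = x ^ r := by
  unfold srpow
  split_ifs with h
  · rw [h, Real.zero_rpow hr.ne']
  · rfl

/-- The spectral decompositions of a density matrix `ρ` and a positive semidefinite matrix `σ`
whose support contains that of `ρ`. -/
structure SpectralPair (ρ σ : Matrix n n ℂ) where
  e : OrthonormalBasis n ℂ (EuclideanSpace ℂ n)
  f : OrthonormalBasis n ℂ (EuclideanSpace ℂ n)
  p : n → ℝ
  q : n → ℝ
  he : IsEigenbasis ρ e p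
  hf : IsEigenbasis σ f q
  p_nonneg : ∀ i, 0 ≤ p i
  q_nonneg : ∀ j, 0 ≤ q j
  sum_p : ∑ i, p i = 1
  inner_eq_zero : ∀ i j, p i ≠ 0 → q j = 0 → inner ℂ (e i) (f j) = 0

lemma nonempty_spectralPair {ρ σ : Matrix n n ℂ} (hρ : IsDensityMatrix ρ) (hσ : σ.PosSemidef)
    (hsupp : supp ρ ≤ supp σ) : Nonempty (SpectralPair ρ σ) := by
  have he := isEigenbasis_eigenvectorBasis hρ.1.1
  have hf := isEigenbasis_eigenvectorBasis hσ.1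
  refine ⟨⟨_, _, _, _, he, hf, hρ.1.eigenvalues_nonneg, hσ.eigenvalues_nonneg, ?_, ?_⟩⟩
  · rw [← he.trace_re, hρ.2, Complex.one_re]
  · intro i j hi hj
    have hmem : hρ.1.1.eigenvectorBasis i ∈ supp ρ := by
      refine ⟨((hρ.1.1.eigenvalues i : ℂ)⁻¹) • hρ.1.1.eigenvectorBasis i, ?_⟩
      rw [map_smul]
      change _ • op ρ _ = _
      rw [he i, smul_smul, inv_mul_cancel₀ (by exact_mod_cast hi), one_smul]
    obtain ⟨y, hy⟩ := hsupp hmem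
    rw [← hy, ← inner_conj_symm]
    change (starRingEnd ℂ) (inner ℂ _ (op σ y)) = 0
    rw [hf.inner_basis_op, hj]
    simp

namespace SpectralPair

variable {ρ σ : Matrix n n ℂ} (D : SpectralPair ρ σ)

/-- The overlaps of the two eigenbases. -/
def w (i j : n) : ℝ := ‖(inner ℂ (D.e i) (D.f j) : ℂ)‖ ^ 2

lemma w_nonneg (i j : n) : 0 ≤ D.w i j := sq_nonneg _

lemma sum_w_right (i : n) : ∑ j, D.w i j = 1 := by
  unfold w
  rw [D.f.sum_sq_norm_inner_left, D.e.orthonormal.1 i, one_pow]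

/-- The support hypothesis in the form used below: wherever the joint weight is nonzero, logarithms
and negative powers are taken at positive eigenvalues. -/
lemma q_pos {i j : n} (hi : D.p i ≠ 0) (hj : D.w i j ≠ 0) : 0 < D.q j := by
  refine lt_of_le_of_ne (D.q_nonneg j) fun h => hj ?_
  simp [w, D.inner_eq_zero i j hi h.symm]

lemma p_pos {i : n} (hi : D.p i ≠ 0) : 0 < D.p i := lt_of_le_of_ne (D.p_nonneg i) hi.symm

lemma exists_p_ne_zero : ∃ i, D.p i ≠ 0 := by
  by_contra! h
  have := D.sum_p
  simp [h] at this

/-- The joint distribution of the eigenvalues of `ρ` and of `σ`. -/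
def P (m : n × n) : ℝ := D.p m.1 * D.w m.1 m.2

/-- The log-likelihood ratio of the eigenvalues. -/
def X (m : n × n) : ℝ := Real.log (D.p m.1) - Real.log (D.q m.2)

lemma P_nonneg (m : n × n) : 0 ≤ D.P m := mul_nonneg (D.p_nonneg _) (D.w_nonneg _ _)

lemma sum_P : ∑ m, D.P m = 1 := by
  rw [Fintype.sum_prod_type]
  simp_rw [P, ← Finset.mul_sum, D.sum_w_right, mul_one, D.sum_p]

lemma P_ne_zero {m : n × n} (h : D.P m ≠ 0) : D.p m.1 ≠ 0 ∧ D.w m.1 m.2 ≠ 0 :=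
  mul_ne_zero_iff.mp h

lemma relEntropy_eq : relEntropy ρ σ = ∑ m, D.P m * D.X m := by
  rw [Fintype.sum_prod_type]
  unfold relEntropy suppLog
  rw [(D.he.mul (D.he.cfc Real.log)).trace_re, D.he.trace_mul_re (D.hf.cfc Real.log),
    ← Finset.sum_sub_distrib]
  refine Finset.sum_congr rfl fun i _ => ?_
  have : D.p i * Real.log (D.p i) = ∑ j, D.p i * Real.log (D.p i) * D.w i j := by
    rw [← Finset.mul_sum, D.sum_w_right, mul_one]
  rw [this, ← Finset.sum_sub_distrib]
  refine Finset.sum_congr rfl fun j _ => ?_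
  simp only [P, X, w]
  ring

/-- On pairs of nonzero weight, `p ^ α * q ^ (1 - α) = p * exp ((α - 1) X)`; the other pairs
contribute zero on both sides because `0` is sent to `0`. Every real `α` is allowed, including `0`.
-/
lemma trace_suppPow_mul_suppPow (α : ℝ) :
    (suppPow ρ α * suppPow σ (1 - α)).trace.re
      = ∑ m, D.P m * Real.exp ((α - 1) * D.X m) := by
  rw [suppPow_eq, suppPow_eq, (D.he.cfc _).trace_mul_re (D.hf.cfc _), Fintype.sum_prod_type]
  refine Finset.sum_congr rfl fun i _ => Finset.sum_congr rfl fun j _ => ?_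
  by_cases hi : D.p i = 0
  · simp [P, hi, srpow_zero]
  by_cases hj : D.w i j = 0
  · have : ‖(inner ℂ (D.e i) (D.f j) : ℂ)‖ ^ 2 = 0 := hj
    simp [P, hj, this]
  have hp := D.p_pos hi
  have hq := D.q_pos hi hj
  rw [srpow_of_pos hp, srpow_of_pos hq]
  simp only [P, X, w]
  rw [Real.rpow_def_of_pos hp, Real.rpow_def_of_pos hq, ← Real.exp_add]
  have : Real.log (D.p i) * α + Real.log (D.q j) * (1 - α)
    = Real.log (D.p i) + (α - 1) * (Real.log (D.p i) - Real.log (D.q j)) := by ring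
  rw [this, Real.exp_add, Real.exp_log hp]
  ring

lemma renyiFormula_eq (α : ℝ) : renyiFormula ρ σ α
    = 1 / (α - 1) * Real.log (∑ m, D.P m * Real.exp ((α - 1) * D.X m)) := by
  rw [renyiFormula, D.trace_suppPow_mul_suppPow]

/-! ### Condition 7 as constancy of the log-likelihood ratio. -/

/-- Every eigenvector of `ρ` in its support is an eigenvector of `σ`, and the quotient of the
eigenvalues is `c`. -/
def Scale (c : ℝ) : Prop :=
  0 < c ∧ ∀ i, D.p i ≠ 0 → op σ (D.e i) = ((D.p i / c : ℝ) : ℂ) • D.e i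

lemma mem_supp_of_ne_zero {i : n} (hi : D.p i ≠ 0) : D.e i ∈ supp ρ := by
  refine ⟨((D.p i : ℂ)⁻¹) • D.e i, ?_⟩
  rw [map_smul]
  change _ • op ρ _ = _
  rw [D.he i, smul_smul, inv_mul_cancel₀ (by exact_mod_cast hi), one_smul]

lemma op_suppProj_of_mem {x : EuclideanSpace ℂ n} (hx : x ∈ supp ρ) : op (suppProj ρ) x = x := by
  unfold op suppProj
  rw [LinearEquiv.apply_symm_apply]
  exact Submodule.starProjection_eq_self_iff.mpr hx

lemma op_suppProj_of_mem_orthogonal {x : EuclideanSpace ℂ n} (hx : x ∈ (supp ρ)ᗮ) :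
    op (suppProj ρ) x = 0 := by
  unfold op suppProj
  rw [LinearEquiv.apply_symm_apply]
  exact (Submodule.starProjection_apply_eq_zero_iff _).mpr hx

/-- Commutation keeps `σ (e i)` in the support of `ρ`, so the projection drops out and `p i • e i =
c • σ (e i)`. The sign of `c` follows from positivity of `σ` at one such vector. -/
lemma exists_scale (h : Commute ρ σ ∧ ∃ c : ℝ, ρ = c • (suppProj ρ * σ)) :
    ∃ c, D.Scale c := by
  obtain ⟨hcomm, c, hc⟩ := h
  have key : ∀ i, D.p i ≠ 0 → (D.p i : ℂ) • D.e i = (c : ℂ) • op σ (D.e i) := by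
    intro i hi
    have hmem : op σ (D.e i) ∈ supp ρ := by
      obtain ⟨y, hy⟩ := D.mem_supp_of_ne_zero hi
      refine ⟨op σ y, ?_⟩
      change op ρ (op σ y) = _
      rw [← op_mul, hcomm.eq, op_mul]
      congr 1
    have h1 : op ρ (D.e i) = (c : ℂ) • op σ (D.e i) := by
      have h2 := congrArg (fun A => op A (D.e i)) hc
      rwa [op_smul, op_mul, op_suppProj_of_mem hmem] at h2
    rw [← h1, D.he i]
  obtain ⟨i₀, hi₀⟩ := D.exists_p_ne_zero
  have hc0 : c ≠ 0 := by
    rintro rfl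
    have := key i₀ hi₀
    rw [Complex.ofReal_zero, zero_smul, smul_eq_zero] at this
    rcases this with h | h
    · exact hi₀ (by exact_mod_cast h)
    · exact D.e.orthonormal.ne_zero i₀ h
  have key2 : ∀ i, D.p i ≠ 0 → op σ (D.e i) = ((D.p i / c : ℝ) : ℂ) • D.e i := by
    intro i hi
    have : op σ (D.e i) = (c : ℂ)⁻¹ • ((D.p i : ℂ) • D.e i) := by
      rw [key i hi, smul_smul, inv_mul_cancel₀ (by exact_mod_cast hc0), one_smul]
    rw [this, smul_smul]
    push_cast
    congr 1
    ring
  refine ⟨c, ?_, key2⟩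
  have h1 := D.hf.re_inner_op_self (D.e i₀)
  rw [key2 i₀ hi₀, inner_smul_right, inner_self_eq_norm_sq_to_K, D.e.orthonormal.1 i₀] at h1
  have h2 : 0 ≤ D.p i₀ / c := by
    have h3 : 0 ≤ ∑ i, D.q i * ‖(inner ℂ (D.f i) (D.e i₀) : ℂ)‖ ^ 2 :=
      Finset.sum_nonneg fun j _ => mul_nonneg (D.q_nonneg j) (sq_nonneg _)
    rw [← h1] at h3
    simpa using h3
  have h3 := D.p_pos hi₀
  rcases lt_or_gt_of_ne hc0 with h | h
  · exact absurd (div_neg_of_pos_of_neg h3 h) (not_lt.mpr h2)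
  · exact h

variable {D}

/-- For `e i` in the kernel of `ρ`, symmetry of `σ` makes `σ (e i)` orthogonal to every `e k` with
`p k ≠ 0`, these being eigenvectors of `σ`; hence `ρ` kills it. -/
lemma Scale.commute {c : ℝ} (h : D.Scale c) : Commute ρ σ := by
  refine ext_of_basis D.e fun i => ?_
  rw [op_mul, op_mul, D.he i, map_smul]
  by_cases hi : D.p i = 0
  · rw [hi, Complex.ofReal_zero, zero_smul, D.he.op_apply]
    refine Finset.sum_eq_zero fun k _ => ?_
    by_cases hk : D.p k = 0
    · simp [hk]
    · rw [← inner_op_left D.hf.isHermitian, h.2 k hk, inner_smul_left,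
        D.e.orthonormal.2 (show k ≠ i by rintro rfl; exact hk hi)]
      simp
  · rw [h.2 i hi, map_smul, D.he i, smul_comm]

lemma Scale.eq_smul {c : ℝ} (h : D.Scale c) : ρ = c • (suppProj ρ * σ) := by
  refine ext_of_basis D.e fun i => ?_
  rw [op_smul, op_mul, D.he i]
  by_cases hi : D.p i = 0
  · have : op σ (D.e i) ∈ (supp ρ)ᗮ := by
      rw [Submodule.mem_orthogonal]
      rintro _ ⟨y, rfl⟩
      change inner ℂ (op ρ y) _ = 0
      rw [inner_op_left D.he.isHermitian, ← op_mul, h.commute.eq, op_mul, D.he i, hi]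
      simp
    rw [op_suppProj_of_mem_orthogonal this, hi]
    simp
  · rw [h.2 i hi, map_smul, op_suppProj_of_mem (D.mem_supp_of_ne_zero hi), smul_smul,
      ← Complex.ofReal_mul, mul_div_cancel₀ _ h.1.ne']

/-- Two eigenvectors of `σ` with nonzero overlap have the same eigenvalue, so `q j = p i / c`. -/
lemma Scale.X_eq {c : ℝ} (h : D.Scale c) {m : n × n} (hm : D.P m ≠ 0) : D.X m = Real.log c := by
  obtain ⟨hi, hj⟩ := D.P_ne_zero hm
  have hp := D.p_pos hi
  have hq := D.q_pos hi hj
  have h1 : (D.q m.2 : ℂ) * inner ℂ (D.f m.2) (D.e m.1)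
      = ((D.p m.1 / c : ℝ) : ℂ) * inner ℂ (D.f m.2) (D.e m.1) := by
    rw [← D.hf.inner_basis_op, h.2 _ hi, inner_smul_right]
  have h2 : (inner ℂ (D.f m.2) (D.e m.1) : ℂ) ≠ 0 := by
    intro h0
    apply hj
    simp [w, norm_inner_symm (D.e m.1), h0]
  have h3 : D.q m.2 = D.p m.1 / c := by exact_mod_cast mul_right_cancel₀ h2 h1
  rw [X, h3, Real.log_div hp.ne' h.1.ne']
  ring

lemma Scale.relEntropy_eq {c : ℝ} (h : D.Scale c) : relEntropy ρ σ = Real.log c := by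
  rw [D.relEntropy_eq]
  calc ∑ m, D.P m * D.X m = ∑ m, D.P m * Real.log c := by
        refine Finset.sum_congr rfl fun m _ => ?_
        by_cases hm : D.P m = 0
        · simp [hm]
        · rw [h.X_eq hm]
    _ = Real.log c := by rw [← Finset.sum_mul, D.sum_P, one_mul]

lemma Scale.renyiFormula_eq {c : ℝ} (h : D.Scale c) {α : ℝ} (hα : α ≠ 1) :
    renyiFormula ρ σ α = Real.log c := by
  rw [D.renyiFormula_eq]
  have : ∑ m, D.P m * Real.exp ((α - 1) * D.X m) = Real.exp ((α - 1) * Real.log c) := by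
    calc ∑ m, D.P m * Real.exp ((α - 1) * D.X m)
        = ∑ m, D.P m * Real.exp ((α - 1) * Real.log c) := by
          refine Finset.sum_congr rfl fun m _ => ?_
          by_cases hm : D.P m = 0
          · simp [hm]
          · rw [h.X_eq hm]
      _ = _ := by rw [← Finset.sum_mul, D.sum_P, one_mul]
  rw [this, Real.log_exp]
  field_simp [sub_ne_zero.mpr hα]

variable (D)

/-- In the expansion of `e i` along `f`, only vectors overlapping with it occur, and they all have
the eigenvalue `p i / exp S`. -/
lemma scale_of_X_eq {S : ℝ} (h : ∀ m, D.P m ≠ 0 → D.X m = S) : D.Scale (Real.exp S) := by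
  refine ⟨Real.exp_pos _, fun i hi => ?_⟩
  rw [D.hf.op_apply]
  conv_rhs => rw [← D.f.sum_repr' (D.e i), Finset.smul_sum]
  refine Finset.sum_congr rfl fun j _ => ?_
  rw [smul_smul]
  by_cases hj : D.w i j = 0
  · have : (inner ℂ (D.f j) (D.e i) : ℂ) = 0 := by
      rw [w, norm_inner_symm] at hj
      simpa using hj
    simp [this]
  · have hX := h (i, j) (mul_ne_zero hi hj)
    have : D.q j = D.p i / Real.exp S := by
      rw [← hX]
      simp only [X]
      rw [Real.exp_sub, Real.exp_log (D.p_pos hi), Real.exp_log (D.q_pos hi hj)]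
      field_simp [hi, (D.q_pos hi hj).ne']
    rw [this]

lemma condition_of_X_eq {S : ℝ} (h : ∀ m, D.P m ≠ 0 → D.X m = S) :
    Commute ρ σ ∧ ∃ c : ℝ, ρ = c • (suppProj ρ * σ) :=
  ⟨(D.scale_of_X_eq h).commute, _, (D.scale_of_X_eq h).eq_smul⟩

end SpectralPair

/-! ### Values at the orders in `[0, ∞]`. -/

section Orders

variable {f : ℝ → ℝ} {v : ℝ}

lemma hasValueAtOrder_of_const (h : ∀ α, 0 < α → α ≠ 1 → f α = v) (α : ℝ≥0∞) :
    HasValueAtOrder f α v := by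
  unfold HasValueAtOrder
  split_ifs with h0 h1 h2
  · refine tendsto_const_nhds.congr' ?_
    filter_upwards [Ioo_mem_nhdsGT (zero_lt_one (α := ℝ))] with x hx
    exact (h x hx.1 hx.2.ne).symm
  · refine tendsto_const_nhds.congr' ?_
    filter_upwards [self_mem_nhdsWithin, nhdsWithin_le_nhds (lt_mem_nhds zero_lt_one)] with x hx hx'
    exact (h x hx' hx).symm
  · refine tendsto_const_nhds.congr' ?_
    filter_upwards [eventually_gt_atTop 1] with x hx
    exact (h x (by linarith) hx.ne').symm
  · refine h _ (ENNReal.toReal_pos h0 h2) fun h3 => h1 ?_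
    rw [← ENNReal.ofReal_toReal h2, h3, ENNReal.ofReal_one]

lemma derivTendstoAtOne_of_const (h : ∀ α, 0 < α → α ≠ 1 → f α = v) :
    DerivTendstoAtOne f 0 := by
  have key : ∀ᶠ α in 𝓝[≠] (1 : ℝ), HasDerivAt f 0 α := by
    filter_upwards [self_mem_nhdsWithin, nhdsWithin_le_nhds (lt_mem_nhds zero_lt_one)] with x hx hx'
    refine (hasDerivAt_const x v).congr_of_eventuallyEq ?_
    filter_upwards [isOpen_ne.mem_nhds hx, lt_mem_nhds hx'] with y hy hy'
    exact h y hy' hy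
  refine ⟨key.mono fun α hα => hα.differentiableAt, tendsto_const_nhds.congr' ?_⟩
  filter_upwards [key] with α hα
  exact hα.deriv.symm

/-- The orders other than `1`, as a case distinction. -/
lemma HasValueAtOrder.cases {α : ℝ≥0∞} (hα : α ≠ 1) (h : HasValueAtOrder f α v) :
    Tendsto f (𝓝[>] 0) (𝓝 v) ∨ (∃ a : ℝ, 0 < a ∧ a < 1 ∧ f a = v) ∨
      (∃ a : ℝ, 1 < a ∧ f a = v) ∨ Tendsto f atTop (𝓝 v) := by
  unfold HasValueAtOrder at h
  split_ifs at h with h0 h2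
  · exact Or.inl h
  · exact Or.inr (Or.inr (Or.inr h))
  · have hpos := ENNReal.toReal_pos h0 h2
    have hne : α.toReal ≠ 1 := fun h3 => hα (by
      rw [← ENNReal.ofReal_toReal h2, h3, ENNReal.ofReal_one])
    rcases lt_or_gt_of_ne hne with h3 | h3
    · exact Or.inr (Or.inl ⟨_, hpos, h3, h⟩)
    · exact Or.inr (Or.inr (Or.inl ⟨_, h3, h⟩))

end Orders

/-! ### From the conditions on `S_α` to a constant ratio. -/

namespace SpectralPair

variable {ρ σ : Matrix n n ℂ} (D : SpectralPair ρ σ)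

lemma sum_P_exp_pos (s : ℝ) : 0 < ∑ m, D.P m * Real.exp (s * D.X m) :=
  (Real.exp_pos _).trans_le (exp_sum_le_sum_exp D.P_nonneg D.sum_P)

/-- The equality case of Jensen, used with `s = α - 1` for `S_α` and with `s = -1` for the
sandwiched limit at order `0`. -/
lemma X_eq_of_sum_exp_le {s : ℝ} (hs : s ≠ 0)
    (h : ∑ m, D.P m * Real.exp (s * D.X m) ≤ Real.exp (s * relEntropy ρ σ)) (m : n × n)
    (hm : D.P m ≠ 0) : D.X m = relEntropy ρ σ := by
  have hsum : ∑ m, D.P m * (s * D.X m) = s * relEntropy ρ σ := by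
    rw [D.relEntropy_eq, Finset.mul_sum]
    exact Finset.sum_congr rfl fun m _ => by ring
  have := eq_sum_of_sum_exp_le (x := fun m => s * D.X m) D.P_nonneg D.sum_P
    (by rwa [hsum]) m hm
  rw [hsum] at this
  exact mul_left_cancel₀ hs this

lemma X_eq_of_renyiFormula_eq {α : ℝ} (hα : α ≠ 1)
    (h : renyiFormula ρ σ α = relEntropy ρ σ) (m : n × n) (hm : D.P m ≠ 0) :
    D.X m = relEntropy ρ σ := by
  have hs := sub_ne_zero.mpr hα
  refine D.X_eq_of_sum_exp_le hs (le_of_eq ?_) m hm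
  rw [← h, D.renyiFormula_eq, ← mul_assoc, mul_one_div_cancel hs, one_mul,
    Real.exp_log (D.sum_P_exp_pos _)]

lemma X_eq_of_renyiEq {α : ℝ≥0∞} (hα : α ≠ 1) (h : RenyiEq ρ σ α (relEntropy ρ σ))
    (m : n × n) (hm : D.P m ≠ 0) : D.X m = relEntropy ρ σ := by
  rcases HasValueAtOrder.cases hα h with h | ⟨a, _, ha, h⟩ | ⟨a, ha, h⟩ | h
  -- The moment formula is continuous at `0`, so the limit there is the value and order `0` is
  -- treated like any other.
  · refine D.X_eq_of_renyiFormula_eq zero_ne_one ?_ m hm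
    have hc : ContinuousAt (renyiFormula ρ σ) 0 := by
      have : renyiFormula ρ σ = fun α =>
          1 / (α - 1) * Real.log (∑ m, D.P m * Real.exp ((α - 1) * D.X m)) :=
        funext D.renyiFormula_eq
      rw [this]
      refine ContinuousAt.mul (continuousAt_const.div (by fun_prop) (by norm_num)) ?_
      exact ContinuousAt.log (by fun_prop) (D.sum_P_exp_pos _).ne'
    exact tendsto_nhds_unique (hc.tendsto.mono_left nhdsWithin_le_nhds) h
  · exact D.X_eq_of_renyiFormula_eq ha.ne h m hm
  · exact D.X_eq_of_renyiFormula_eq ha.ne' h m hm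
  -- Keeping a single term of the moment gives `X m + ln (P m) / (α - 1) ≤ S_α`. In the limit `X`
  -- never exceeds its own mean `S`.
  · refine eq_of_le_of_le_sum D.P_nonneg D.sum_P (fun m hm => ?_) D.relEntropy_eq.le m hm
    have hP : 0 < D.P m := lt_of_le_of_ne (D.P_nonneg m) hm.symm
    have ht : Tendsto (fun α : ℝ => D.X m + Real.log (D.P m) / (α - 1)) atTop (𝓝 (D.X m + 0)) := by
      refine tendsto_const_nhds.add (Tendsto.div_atTop tendsto_const_nhds ?_)
      exact tendsto_atTop_add_const_right _ _ tendsto_id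
    rw [add_zero] at ht
    refine le_of_tendsto_of_tendsto ht h ?_
    filter_upwards [eventually_gt_atTop 1] with α hα
    have hs : 0 < α - 1 := sub_pos.mpr hα
    rw [D.renyiFormula_eq, one_div, ← div_eq_inv_mul, le_div_iff₀ hs, add_mul,
      div_mul_cancel₀ _ hs.ne', Real.le_log_iff_exp_le (D.sum_P_exp_pos _), add_comm, Real.exp_add,
      Real.exp_log hP, mul_comm (D.X m)]
    exact Finset.single_le_sum (f := fun m => D.P m * Real.exp ((α - 1) * D.X m))
      (fun m _ => mul_nonneg (D.P_nonneg m) (Real.exp_pos _).le) (Finset.mem_univ m)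

/-- Here `exp ((α - 1) (S_α - S))` is the exponential moment of `X - S`, which exceeds `1` by at
least a quarter of the variance times `(α - 1) ^ 2`. The variance must therefore vanish. -/
lemma X_eq_of_deriv_renyiFormula (h : DerivTendstoAtOne (renyiFormula ρ σ) 0)
    (m : n × n) (hm : D.P m ≠ 0) : D.X m = relEntropy ρ σ := by
  have hle : 𝓝[>] (1 : ℝ) ≤ 𝓝[≠] 1 := nhdsWithin_mono _ fun x hx => ne_of_gt hx
  have hS : Tendsto (renyiFormula ρ σ) (𝓝[>] 1) (𝓝 (relEntropy ρ σ)) := by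
    rw [D.relEntropy_eq]
    refine ((tendsto_cumulant_slope (x := D.X) D.sum_P).congr fun α => ?_).mono_left hle
    rw [D.renyiFormula_eq]
  have hsub : Tendsto (fun α : ℝ => α - 1) (𝓝[>] 1) (𝓝 0) := by
    have : Tendsto (fun α : ℝ => α - 1) (𝓝 1) (𝓝 (1 - 1)) :=
      (continuous_id.sub continuous_const).tendsto 1
    rw [sub_self] at this
    exact this.mono_left nhdsWithin_le_nhds
  have hev := hsub.eventually (eventually_one_add_sq_le_sum_exp (x := D.X) D.P_nonneg D.sum_P)
  rw [← D.relEntropy_eq] at hev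
  have hc := h.coeff_nonpos hS
    (c := (∑ m, D.P m * (D.X m - relEntropy ρ σ) ^ 2) / 4) (by
      filter_upwards [hev, self_mem_nhdsWithin] with α hα hα1
      have hs : α - 1 ≠ 0 := sub_ne_zero.mpr (ne_of_gt hα1)
      refine (by linarith : _ ≤ _).trans (hα.trans (le_of_eq ?_))
      have : ∑ m, D.P m * Real.exp ((α - 1) * (D.X m - relEntropy ρ σ))
          = (∑ m, D.P m * Real.exp ((α - 1) * D.X m))
            * Real.exp (-((α - 1) * relEntropy ρ σ)) := by
        rw [Finset.sum_mul]
        refine Finset.sum_congr rfl fun m _ => ?_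
        rw [mul_assoc, ← Real.exp_add]
        ring_nf
      rw [this, D.renyiFormula_eq, mul_sub, ← mul_assoc, mul_one_div_cancel hs, one_mul,
        Real.exp_sub, Real.exp_log (D.sum_P_exp_pos _), Real.exp_neg, div_eq_mul_inv])
  have hnn : ∀ m, 0 ≤ D.P m * (D.X m - relEntropy ρ σ) ^ 2 := fun m =>
    mul_nonneg (D.P_nonneg m) (sq_nonneg _)
  have h0 := (Finset.sum_eq_zero_iff_of_nonneg (fun m _ => hnn m)).mp
    (le_antisymm (by linarith) (Finset.sum_nonneg fun m _ => hnn m)) m (Finset.mem_univ m)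
  rcases mul_eq_zero.mp h0 with h0 | h0
  · exact absurd h0 hm
  · exact sub_eq_zero.mp (pow_eq_zero_iff two_ne_zero |>.mp h0)

end SpectralPair

/-! ### Peierls' inequality and the matrix `ρ ^ (1 / 2) σ ^ s ρ ^ (1 / 2)`. -/

namespace IsEigenbasis

variable {A : Matrix n n ℂ} {b : OrthonormalBasis n ℂ (EuclideanSpace ℂ n)} {a : n → ℝ}

lemma suppPow (h : IsEigenbasis A b a) (r : ℝ) :
    IsEigenbasis (suppPow A r) b (fun i => srpow r (a i)) := h.cfc _

lemma eq_of_eigenbasis {B : Matrix n n ℂ} (h : IsEigenbasis A b a) (h' : IsEigenbasis B b a) :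
    A = B :=
  ext_of_basis b fun i => by rw [h i, h' i]

lemma suppPow_mul_suppPow (h : IsEigenbasis A b a) (ha : ∀ i, 0 ≤ a i) (r s : ℝ) :
    QRenyi.suppPow A r * QRenyi.suppPow A s = QRenyi.suppPow A (r + s) := by
  have h1 := (h.suppPow r).mul (h.suppPow s)
  refine h1.eq_of_eigenbasis ?_
  convert h.suppPow (r + s) using 2 with i
  rcases (ha i).eq_or_lt with h0 | h0
  · rw [← h0]; simp [srpow_zero]
  · rw [srpow_of_pos h0, srpow_of_pos h0, srpow_of_pos h0, Real.rpow_add h0]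

lemma suppPow_one (h : IsEigenbasis A b a) : QRenyi.suppPow A 1 = A := by
  refine (h.suppPow 1).eq_of_eigenbasis ?_
  convert h using 2 with i
  rw [srpow_eq_rpow one_pos, Real.rpow_one]

/-- Peierls' inequality for convex functions. -/
lemma sum_convex_diag_le (h : IsEigenbasis A b a) (ha : ∀ i, 0 ≤ a i) {φ : ℝ → ℝ}
    (hφ : ConvexOn ℝ (Set.Ici 0) φ) (g : OrthonormalBasis n ℂ (EuclideanSpace ℂ n)) :
    ∑ k, φ (inner ℂ (g k) (op A (g k)) : ℂ).re ≤ ∑ i, φ (a i) := by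
  have h1 : ∀ k, φ (inner ℂ (g k) (op A (g k)) : ℂ).re
      ≤ ∑ i, ‖(inner ℂ (b i) (g k) : ℂ)‖ ^ 2 * φ (a i) := by
    intro k
    rw [h.re_inner_op_self]
    have := hφ.map_sum_le (t := Finset.univ) (w := fun i => ‖(inner ℂ (b i) (g k) : ℂ)‖ ^ 2)
      (p := a) (fun i _ => sq_nonneg _)
      (by rw [b.sum_sq_norm_inner_right, g.orthonormal.1 k, one_pow]) (fun i _ => ha i)
    simpa [smul_eq_mul, mul_comm] using this
  refine (Finset.sum_le_sum fun k _ => h1 k).trans (le_of_eq ?_)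
  rw [Finset.sum_comm]
  refine Finset.sum_congr rfl fun i _ => ?_
  rw [← Finset.sum_mul, g.sum_sq_norm_inner_left, b.orthonormal.1 i, one_pow, one_mul]

/-- Peierls' inequality for concave functions. -/
lemma le_sum_concave_diag (h : IsEigenbasis A b a) (ha : ∀ i, 0 ≤ a i) {φ : ℝ → ℝ}
    (hφ : ConcaveOn ℝ (Set.Ici 0) φ) (g : OrthonormalBasis n ℂ (EuclideanSpace ℂ n)) :
    ∑ i, φ (a i) ≤ ∑ k, φ (inner ℂ (g k) (op A (g k)) : ℂ).re := by
  have := h.sum_convex_diag_le ha hφ.neg g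
  simpa using this

end IsEigenbasis

/-- The matrix `ρ ^ (1 / 2) σ ^ s ρ ^ (1 / 2)`. -/
def sandwich (ρ σ : Matrix n n ℂ) (s : ℝ) : Matrix n n ℂ :=
  suppPow ρ (1 / 2) * suppPow σ s * suppPow ρ (1 / 2)

lemma isHermitian_suppPow (A : Matrix n n ℂ) (r : ℝ) : (suppPow A r).IsHermitian :=
  isHermitian_cfc _

lemma isHermitian_mul_mul {m : Type*} [Fintype m] {A B : Matrix m m ℂ} (hA : A.IsHermitian)
    (hB : B.IsHermitian) :
    (A * B * A).IsHermitian := by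
  unfold Matrix.IsHermitian at *
  rw [Matrix.conjTranspose_mul, Matrix.conjTranspose_mul, hA, hB, Matrix.mul_assoc]

lemma isHermitian_sandwich (ρ σ : Matrix n n ℂ) (s : ℝ) : (sandwich ρ σ s).IsHermitian :=
  isHermitian_mul_mul (isHermitian_suppPow _ _) (isHermitian_suppPow _ _)

/-- The two matrices are `(A B)(B A)` and `(B A)(A B)`, which have the same characteristic
polynomial. -/
lemma trace_suppPow_swap {A B : Matrix n n ℂ} (hA : A.IsHermitian) (hB : B.IsHermitian) (α : ℝ) :
    (suppPow (A * (B * B) * A) α).trace.re = (suppPow (B * (A * A) * B) α).trace.re := by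
  have hself : ∀ {M : Matrix n n ℂ}, M.IsHermitian → (M * M).IsHermitian := fun {M} hM => by
    unfold Matrix.IsHermitian at *
    rw [Matrix.conjTranspose_mul, hM]
  refine trace_cfc_eq_of_charpoly_eq (isHermitian_mul_mul hA (hself hB))
    (isHermitian_mul_mul hB (hself hA)) ?_ _
  rw [show A * (B * B) * A = (A * B) * (B * A) by simp only [Matrix.mul_assoc],
    show B * (A * A) * B = (B * A) * (A * B) by simp only [Matrix.mul_assoc],
    Matrix.charpoly_mul_comm]

namespace SpectralPair

variable {ρ σ : Matrix n n ℂ} (D : SpectralPair ρ σ)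

/-- The square root of `ρ`, as an operator. -/
def R (_ : SpectralPair ρ σ) : EuclideanSpace ℂ n →ₗ[ℂ] EuclideanSpace ℂ n :=
  op (suppPow ρ (1 / 2))

lemma R_e (i : n) : D.R (D.e i) = (√(D.p i) : ℂ) • D.e i := by
  unfold R
  rw [D.he.suppPow _ i]
  beta_reduce
  rw [srpow_eq_rpow (by norm_num), Real.sqrt_eq_rpow]

lemma inner_R_left (x y : EuclideanSpace ℂ n) : inner ℂ (D.R x) y = inner ℂ x (D.R y) :=
  inner_op_left (isHermitian_suppPow _ _) x y

/-- An orthonormal eigenbasis of `ρ ^ (1 / 2) σ ^ s ρ ^ (1 / 2)`. -/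
def g (_ : SpectralPair ρ σ) (s : ℝ) : OrthonormalBasis n ℂ (EuclideanSpace ℂ n) :=
  (isHermitian_sandwich ρ σ s).eigenvectorBasis

/-- The eigenvalues of `ρ ^ (1 / 2) σ ^ s ρ ^ (1 / 2)`. -/
def lam (_ : SpectralPair ρ σ) (s : ℝ) : n → ℝ := (isHermitian_sandwich ρ σ s).eigenvalues

lemma isEigenbasis_g (s : ℝ) : IsEigenbasis (sandwich ρ σ s) (D.g s) (D.lam s) :=
  isEigenbasis_eigenvectorBasis _

lemma inner_sandwich (s : ℝ) (x y : EuclideanSpace ℂ n) :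
    inner ℂ x (op (sandwich ρ σ s) y) = inner ℂ (D.R x) (op (suppPow σ s) (D.R y)) := by
  rw [sandwich, op_mul, op_mul, D.inner_R_left]
  rfl

lemma re_inner_sandwich_self (s : ℝ) (x : EuclideanSpace ℂ n) :
    (inner ℂ x (op (sandwich ρ σ s) x) : ℂ).re
      = ∑ j, srpow s (D.q j) * ‖(inner ℂ (D.f j) (D.R x) : ℂ)‖ ^ 2 := by
  rw [D.inner_sandwich, (D.hf.suppPow s).re_inner_op_self]

lemma lam_eq (s : ℝ) (k : n) :
    D.lam s k = ∑ j, srpow s (D.q j) * ‖(inner ℂ (D.f j) (D.R (D.g s k)) : ℂ)‖ ^ 2 := by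
  rw [← D.re_inner_sandwich_self, D.isEigenbasis_g s k, inner_smul_right,
    inner_self_eq_norm_sq_to_K, (D.g s).orthonormal.1 k]
  simp

lemma lam_nonneg (s : ℝ) (k : n) : 0 ≤ D.lam s k := by
  rw [D.lam_eq]
  exact Finset.sum_nonneg fun j _ => mul_nonneg (srpow_nonneg (D.q_nonneg j) s) (sq_nonneg _)

/-- The diagonal entries of `σ ^ s` in the eigenbasis of `ρ`. -/
def A (s : ℝ) (i : n) : ℝ := ∑ j, D.w i j * srpow s (D.q j)

lemma re_inner_sandwich_e (s : ℝ) (i : n) :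
    (inner ℂ (D.e i) (op (sandwich ρ σ s) (D.e i)) : ℂ).re = D.p i * D.A s i := by
  rw [D.re_inner_sandwich_self, A, Finset.mul_sum]
  refine Finset.sum_congr rfl fun j _ => ?_
  rw [D.R_e, inner_smul_right, norm_mul, mul_pow, w, norm_inner_symm (D.f j)]
  rw [Complex.norm_real, Real.norm_of_nonneg (Real.sqrt_nonneg _), Real.sq_sqrt (D.p_nonneg i)]
  ring

/-- The trace in the sandwiched formula. -/
def trSandwich (α : ℝ) : ℝ := ∑ k, srpow α (D.lam ((1 - α) / α) k)

lemma sandwichedFormula_trace_eq (D : SpectralPair ρ σ) (α : ℝ) :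
    (suppPow (suppPow σ ((1 - α) / (2 * α)) * ρ * suppPow σ ((1 - α) / (2 * α))) α).trace.re
      = (suppPow (sandwich ρ σ ((1 - α) / α)) α).trace.re := by
  have hCC : suppPow σ ((1 - α) / (2 * α)) * suppPow σ ((1 - α) / (2 * α))
      = suppPow σ ((1 - α) / α) := by
    rw [D.hf.suppPow_mul_suppPow D.q_nonneg]
    congr 1
    -- At `α = 0` all the exponents are zero by the convention for division.
    by_cases hα : α = 0
    · simp [hα]
    · field_simp
      ring
  have hRR : suppPow ρ (1 / 2) * suppPow ρ (1 / 2) = ρ := by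
    rw [D.he.suppPow_mul_suppPow D.p_nonneg, add_halves, D.he.suppPow_one]
  rw [sandwich, ← hCC, ← trace_suppPow_swap (isHermitian_suppPow _ _) (isHermitian_suppPow _ _),
    hRR]

lemma sandwichedFormula_eq (α : ℝ) :
    sandwichedFormula ρ σ α = 1 / (α - 1) * Real.log (D.trSandwich α) := by
  rw [sandwichedFormula, D.sandwichedFormula_trace_eq, ((D.isEigenbasis_g _).suppPow α).trace_re]
  rfl

/-- The mean of `ln σ` in the `i`-th eigenvector of `ρ`. -/
def L (i : n) : ℝ := ∑ j, D.w i j * Real.log (D.q j)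

lemma relEntropy_eq_sum_p : relEntropy ρ σ = ∑ i, D.p i * (Real.log (D.p i) - D.L i) := by
  rw [D.relEntropy_eq, Fintype.sum_prod_type]
  refine Finset.sum_congr rfl fun i _ => ?_
  have : Real.log (D.p i) = ∑ j, D.w i j * Real.log (D.p i) := by
    rw [← Finset.sum_mul, D.sum_w_right, one_mul]
  rw [L]
  conv_rhs => rw [this]
  rw [← Finset.sum_sub_distrib, Finset.mul_sum]
  refine Finset.sum_congr rfl fun j _ => ?_
  simp only [P, X]
  ring

variable {D}

lemma srpow_q_pos {i j : n} (hi : D.p i ≠ 0) (hj : D.w i j ≠ 0) (s : ℝ) :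
    0 < srpow s (D.q j) := srpow_pos (D.q_pos hi hj) s

lemma log_srpow_q {i j : n} (hi : D.p i ≠ 0) (hj : D.w i j ≠ 0) (s : ℝ) :
    Real.log (srpow s (D.q j)) = s * Real.log (D.q j) := by
  rw [srpow_of_pos (D.q_pos hi hj), Real.log_rpow (D.q_pos hi hj)]

lemma sum_w_log_srpow {i : n} (hi : D.p i ≠ 0) (s : ℝ) :
    ∑ j, D.w i j * Real.log (srpow s (D.q j)) = s * D.L i := by
  rw [L, Finset.mul_sum]
  refine Finset.sum_congr rfl fun j _ => ?_
  by_cases hj : D.w i j = 0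
  · simp [hj]
  · rw [log_srpow_q hi hj]
    ring

lemma A_pos {i : n} (hi : D.p i ≠ 0) (s : ℝ) : 0 < D.A s i :=
  sum_pos_of_weights (D.w_nonneg i) (D.sum_w_right i) fun _ hj => srpow_q_pos hi hj s

lemma mul_L_le_log_A {i : n} (hi : D.p i ≠ 0) (s : ℝ) : s * D.L i ≤ Real.log (D.A s i) := by
  rw [← sum_w_log_srpow hi]
  exact sum_log_le_log_sum (D.w_nonneg i) (D.sum_w_right i) fun j hj => srpow_q_pos hi hj s

/-- Equality in Jensen for the distribution of `ln σ` in the state `e i`. -/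
lemma log_q_eq_L {i : n} (hi : D.p i ≠ 0) {s : ℝ} (hs : s ≠ 0)
    (h : Real.log (D.A s i) ≤ s * D.L i) {j : n} (hj : D.w i j ≠ 0) :
    Real.log (D.q j) = D.L i := by
  have := log_eq_sum_of_log_sum_le (D.w_nonneg i) (D.sum_w_right i)
    (fun j hj => srpow_q_pos hi hj s) (by rw [sum_w_log_srpow hi]; exact h) j hj
  rw [sum_w_log_srpow hi, log_srpow_q hi hj] at this
  exact mul_left_cancel₀ hs this

variable (D)

/-- Constancy in two stages: `h2` removes the dependence of `ln (q j)` on `j` within each `i`, and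
`h1` the remaining dependence on `i`. -/
lemma X_eq_of_L {S s : ℝ} (hs : s ≠ 0) (h1 : ∀ i, D.p i ≠ 0 → Real.log (D.p i) - D.L i = S)
    (h2 : ∀ i, D.p i ≠ 0 → Real.log (D.A s i) ≤ s * D.L i) (m : n × n) (hm : D.P m ≠ 0) :
    D.X m = S := by
  obtain ⟨hi, hj⟩ := D.P_ne_zero hm
  rw [X, log_q_eq_L hi hs (h2 _ hi) hj, h1 _ hi]

/-! ### Sandwiched orders above `1` and the order `∞`. -/

/-- The exponent in the lower bound of the sandwiched trace. -/
def Z (α : ℝ) (i : n) : ℝ := (α - 1) * Real.log (D.p i) + α * Real.log (D.A ((1 - α) / α) i)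

lemma le_Z {α : ℝ} (hα : 0 < α) {i : n} (hi : D.p i ≠ 0) :
    (α - 1) * (Real.log (D.p i) - D.L i) ≤ D.Z α i := by
  have := mul_le_mul_of_nonneg_left (mul_L_le_log_A hi ((1 - α) / α)) hα.le
  rw [← mul_assoc, mul_div_cancel₀ _ hα.ne'] at this
  rw [Z]
  linarith

lemma p_mul_exp_Z {α : ℝ} (hα : 0 < α) (i : n) :
    D.p i * Real.exp (D.Z α i) = (D.p i * D.A ((1 - α) / α) i) ^ α := by
  by_cases hi : D.p i = 0
  · rw [hi, zero_mul, zero_mul, Real.zero_rpow hα.ne']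
  · have hp := D.p_pos hi
    have hA := A_pos hi ((1 - α) / α)
    rw [Real.rpow_def_of_pos (mul_pos hp hA), Real.log_mul hp.ne' hA.ne']
    nth_rewrite 1 [← Real.exp_log hp]
    rw [← Real.exp_add, Z]
    ring_nf

/-- Peierls' inequality for the convex function `x ^ α` in the eigenbasis of `ρ`, where the diagonal
entries are `p i * A s i`; `Z` rewrites their powers as an expectation under `p`. -/
lemma sum_exp_Z_le_trSandwich {α : ℝ} (hα : 1 < α) :
    ∑ i, D.p i * Real.exp (D.Z α i) ≤ D.trSandwich α := by
  have h0 : 0 < α := by linarith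
  have := (D.isEigenbasis_g ((1 - α) / α)).sum_convex_diag_le (D.lam_nonneg _)
    (convexOn_rpow hα.le) D.e
  unfold trSandwich
  simp_rw [srpow_eq_rpow h0]
  refine le_trans (le_of_eq ?_) this
  refine Finset.sum_congr rfl fun i _ => ?_
  rw [D.re_inner_sandwich_e, D.p_mul_exp_Z h0]

lemma mul_relEntropy_le_sum_Z {α : ℝ} (hα : 0 < α) :
    (α - 1) * relEntropy ρ σ ≤ ∑ i, D.p i * D.Z α i := by
  rw [D.relEntropy_eq_sum_p, Finset.mul_sum]
  refine Finset.sum_le_sum fun i _ => ?_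
  by_cases hi : D.p i = 0
  · simp [hi]
  · calc _ = D.p i * ((α - 1) * (Real.log (D.p i) - D.L i)) := by ring
      _ ≤ _ := mul_le_mul_of_nonneg_left (D.le_Z hα hi) (D.p_nonneg i)

lemma exp_le_trSandwich {α : ℝ} (hα : 1 < α) :
    Real.exp ((α - 1) * relEntropy ρ σ) ≤ D.trSandwich α :=
  (Real.exp_le_exp.mpr (D.mul_relEntropy_le_sum_Z (by linarith))).trans
    ((exp_sum_le_sum_exp D.p_nonneg D.sum_p).trans (D.sum_exp_Z_le_trSandwich hα))

lemma trSandwich_pos {α : ℝ} (hα : 1 < α) : 0 < D.trSandwich α :=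
  (Real.exp_pos _).trans_le (D.exp_le_trSandwich hα)

lemma exp_sandwichedFormula {α : ℝ} (hα : α ≠ 1) (hpos : 0 < D.trSandwich α) :
    Real.exp ((α - 1) * sandwichedFormula ρ σ α) = D.trSandwich α := by
  rw [D.sandwichedFormula_eq, ← mul_assoc, mul_one_div_cancel (sub_ne_zero.mpr hα), one_mul,
    Real.exp_log hpos]

lemma relEntropy_le_sandwichedFormula (D : SpectralPair ρ σ) {α : ℝ} (hα : 1 < α) :
    relEntropy ρ σ ≤ sandwichedFormula ρ σ α := by
  have h := D.exp_le_trSandwich hα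
  rw [← D.exp_sandwichedFormula hα.ne' (D.trSandwich_pos hα), Real.exp_le_exp] at h
  exact le_of_mul_le_mul_left h (by linarith)

/-- Equality collapses the chain behind `exp_le_trSandwich`. First `Z ≤ (α - 1) S`; then `ln (p i) -
L i` is at most its mean `S`, hence equal to it; what is left is equality in Jensen for `A`. -/
lemma X_eq_of_sandwichedFormula_eq_of_one_lt {α : ℝ} (hα : 1 < α)
    (h : sandwichedFormula ρ σ α = relEntropy ρ σ) (m : n × n) (hm : D.P m ≠ 0) :
    D.X m = relEntropy ρ σ := by
  have h0 : 0 < α := by linarith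
  have hα1 : 0 < α - 1 := by linarith
  have htr := D.exp_sandwichedFormula hα.ne' (D.trSandwich_pos hα)
  rw [h] at htr
  have hle : ∑ i, D.p i * Real.exp (D.Z α i) ≤ Real.exp (∑ i, D.p i * D.Z α i) :=
    ((D.sum_exp_Z_le_trSandwich hα).trans htr.ge).trans
      (Real.exp_le_exp.mpr (D.mul_relEntropy_le_sum_Z h0))
  have hsum : ∑ i, D.p i * D.Z α i ≤ (α - 1) * relEntropy ρ σ := by
    rw [← Real.exp_le_exp, htr]
    exact (exp_sum_le_sum_exp D.p_nonneg D.sum_p).trans (D.sum_exp_Z_le_trSandwich hα)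
  have hZ : ∀ i, D.p i ≠ 0 → D.Z α i ≤ (α - 1) * relEntropy ρ σ := fun i hi =>
    (eq_sum_of_sum_exp_le D.p_nonneg D.sum_p hle i hi).le.trans hsum
  have hY : ∀ i, D.p i ≠ 0 → Real.log (D.p i) - D.L i = relEntropy ρ σ := by
    refine eq_of_le_of_le_sum D.p_nonneg D.sum_p (fun i hi => ?_) D.relEntropy_eq_sum_p.le
    exact le_of_mul_le_mul_left ((D.le_Z h0 hi).trans (hZ i hi)) hα1
  refine D.X_eq_of_L (s := (1 - α) / α) (div_ne_zero (by linarith) h0.ne') hY (fun i hi => ?_) m hm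
  have h1 := hZ i hi
  rw [← hY i hi, Z] at h1
  rw [div_mul_eq_mul_div, le_div_iff₀ h0]
  linarith

lemma continuous_A (i : n) : Continuous (fun s => D.A s i) := by
  unfold A
  refine continuous_finsetSum _ fun j _ => continuous_const.mul ?_
  unfold srpow
  by_cases hq : D.q j = 0
  · simp only [hq, if_true]
    exact continuous_const
  · simp only [hq, if_false]
    exact Real.continuous_const_rpow hq

/-- The exponent `s` tends to `-1`, and one diagonal entry alone gives `ln (p i) + ln (A (-1) i) ≤
S`. As `-L i ≤ ln (A (-1) i)`, the argument ends as for finite orders. -/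
lemma X_eq_of_tendsto_atTop (h : Tendsto (sandwichedFormula ρ σ) atTop (𝓝 (relEntropy ρ σ)))
    (m : n × n) (hm : D.P m ≠ 0) : D.X m = relEntropy ρ σ := by
  have hbound : ∀ i, D.p i ≠ 0 → Real.log (D.p i) + Real.log (D.A (-1) i) ≤ relEntropy ρ σ := by
    intro i hi
    have hinv : Tendsto (fun α : ℝ => 1 / α) atTop (𝓝 0) := by
      simpa using tendsto_inv_atTop_zero (𝕜 := ℝ)
    have hs : Tendsto (fun α : ℝ => (1 - α) / α) atTop (𝓝 (-1)) := by
      have h1 : Tendsto (fun α : ℝ => 1 / α - 1) atTop (𝓝 (0 - 1)) := hinv.sub_const 1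
      rw [zero_sub] at h1
      refine h1.congr' ?_
      filter_upwards [eventually_gt_atTop 0] with α hα
      field_simp
    have hd : Tendsto (fun α : ℝ => 1 / (α - 1)) atTop (𝓝 0) :=
      hinv.comp (tendsto_atTop_add_const_right _ _ tendsto_id)
    have hA : Tendsto (fun α : ℝ => Real.log (D.A ((1 - α) / α) i)) atTop
        (𝓝 (Real.log (D.A (-1) i))) :=
      (((D.continuous_A i).tendsto (-1)).comp hs).log (A_pos hi _).ne'
    have ht : Tendsto (fun α : ℝ => (1 + 1 / (α - 1))
          * (Real.log (D.p i) + Real.log (D.A ((1 - α) / α) i))) atTop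
        (𝓝 ((1 + 0) * (Real.log (D.p i) + Real.log (D.A (-1) i)))) :=
      (hd.const_add 1).mul (hA.const_add _)
    rw [add_zero, one_mul] at ht
    refine le_of_tendsto_of_tendsto ht h ?_
    filter_upwards [eventually_gt_atTop 1] with α hα
    have h0 : 0 < α := by linarith
    have hα1 : 0 < α - 1 := by linarith
    have hle : (D.p i * D.A ((1 - α) / α) i) ^ α ≤ D.trSandwich α := by
      refine le_trans ?_ (D.sum_exp_Z_le_trSandwich hα)
      rw [← D.p_mul_exp_Z h0]
      exact Finset.single_le_sum (f := fun i => D.p i * Real.exp (D.Z α i))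
        (fun i _ => mul_nonneg (D.p_nonneg i) (Real.exp_pos _).le) (Finset.mem_univ i)
    have hpos := mul_pos (D.p_pos hi) (A_pos hi ((1 - α) / α))
    have hlog := Real.log_le_log (Real.rpow_pos_of_pos hpos α) hle
    rw [Real.log_rpow hpos, Real.log_mul (D.p_pos hi).ne' (A_pos hi _).ne'] at hlog
    rw [D.sandwichedFormula_eq]
    have e1 : 1 + 1 / (α - 1) = 1 / (α - 1) * α := by
      field_simp
      ring
    rw [e1, mul_assoc]
    exact mul_le_mul_of_nonneg_left hlog (by positivity)
  have hY : ∀ i, D.p i ≠ 0 → Real.log (D.p i) - D.L i = relEntropy ρ σ := by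
    refine eq_of_le_of_le_sum D.p_nonneg D.sum_p (fun i hi => ?_) D.relEntropy_eq_sum_p.le
    have := mul_L_le_log_A hi (-1)
    linarith [hbound i hi]
  refine D.X_eq_of_L (s := -1) (by norm_num) hY (fun i hi => ?_) m hm
  have h1 := hbound i hi
  rw [← hY i hi] at h1
  linarith

end SpectralPair

/-! ### The limit of the sandwiched quantity at `1` from the right. -/

lemma IsEigenbasis.pow {A : Matrix n n ℂ} {b : OrthonormalBasis n ℂ (EuclideanSpace ℂ n)}
    {a : n → ℝ} (h : IsEigenbasis A b a) (m : ℕ) : IsEigenbasis (A ^ m) b (fun i => a i ^ m) := by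
  induction m with
  | zero =>
    intro i
    simp [op]
  | succ m ih =>
    simp_rw [pow_succ]
    exact ih.mul h

lemma continuous_suppPow {A : Matrix n n ℂ} (hA : A.IsHermitian) :
    Continuous (fun s => suppPow A s) := by
  have : (fun s => suppPow A s) = fun s => (hA.eigenvectorUnitary : Matrix n n ℂ)
      * Matrix.diagonal (RCLike.ofReal ∘ srpow s ∘ hA.eigenvalues)
      * star (hA.eigenvectorUnitary : Matrix n n ℂ) := by
    funext s
    rw [suppPow_eq, hA.cfc_eq, Matrix.IsHermitian.cfc, Unitary.conjStarAlgAut_apply]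
  rw [this]
  refine (continuous_const.matrix_mul (Continuous.matrix_diagonal ?_)).matrix_mul continuous_const
  refine continuous_pi fun i => Complex.continuous_ofReal.comp ?_
  unfold srpow
  by_cases hq : hA.eigenvalues i = 0
  · simp only [Function.comp_apply, hq, if_true]
    exact continuous_const
  · simp only [Function.comp_apply, hq, if_false]
    exact Real.continuous_const_rpow hq

namespace SpectralPair

variable {ρ σ : Matrix n n ℂ} (D : SpectralPair ρ σ)

lemma continuous_sandwich (D : SpectralPair ρ σ) : Continuous (fun s => sandwich ρ σ s) :=
  (continuous_const.matrix_mul (continuous_suppPow D.hf.isHermitian)).matrix_mul continuous_const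

/-- With powers taken on the support, `σ ^ 0` is the support projection and not the identity; it
fixes the support of `ρ`. -/
lemma op_suppPow_zero {i : n} (hi : D.p i ≠ 0) : op (suppPow σ 0) (D.e i) = D.e i := by
  rw [(D.hf.suppPow 0).op_apply]
  conv_rhs => rw [← D.f.sum_repr' (D.e i)]
  refine Finset.sum_congr rfl fun j _ => ?_
  by_cases hj : D.w i j = 0
  · have : (inner ℂ (D.f j) (D.e i) : ℂ) = 0 := by
      rw [w, norm_inner_symm] at hj
      simpa using hj
    simp [this]
  · rw [srpow_of_pos (D.q_pos hi hj)]
    simp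

lemma sandwich_zero (D : SpectralPair ρ σ) : sandwich ρ σ 0 = ρ := by
  refine ext_of_basis D.e fun i => ?_
  have hR := D.R_e i
  unfold R at hR
  rw [D.he i, sandwich, op_mul, op_mul, hR, map_smul, map_smul]
  by_cases hi : D.p i = 0
  · simp [hi]
  · rw [D.op_suppPow_zero hi, hR, smul_smul, ← Complex.ofReal_mul, Real.mul_self_sqrt (D.p_nonneg i)]

/-- Power sums are traces of matrix powers, so no individual eigenvalue has to be followed in `s`.
-/
lemma continuous_sum_lam_pow (m : ℕ) : Continuous (fun s => ∑ k, D.lam s k ^ m) := by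
  have : (fun s => ∑ k, D.lam s k ^ m) = fun s => ((sandwich ρ σ s) ^ m).trace.re := by
    funext s
    rw [((D.isEigenbasis_g s).pow m).trace_re]
  rw [this]
  exact Complex.continuous_re.comp (D.continuous_sandwich.pow m).matrix_trace

lemma sum_lam_zero_pow (m : ℕ) : ∑ k, D.lam 0 k ^ m = ∑ i, D.p i ^ m := by
  rw [← ((D.isEigenbasis_g 0).pow m).trace_re, D.sandwich_zero, (D.he.pow m).trace_re]

lemma sum_lam (s : ℝ) : ∑ k, D.lam s k = ∑ i, D.p i * D.A s i := by
  rw [← (D.isEigenbasis_g s).trace_re, trace_eq_sum_inner_op _ D.e, Complex.re_sum]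
  exact Finset.sum_congr rfl fun i _ => D.re_inner_sandwich_e s i

lemma tendsto_sum_polynomial_lam (r : Polynomial ℝ) :
    Tendsto (fun s => ∑ k, r.eval (D.lam s k)) (𝓝 0) (𝓝 (∑ i, r.eval (D.p i))) := by
  have h1 : ∀ a : n → ℝ, ∑ k, r.eval (a k)
      = ∑ m ∈ Finset.range (r.natDegree + 1), r.coeff m * ∑ k, a k ^ m := by
    intro a
    simp_rw [Polynomial.eval_eq_sum_range, Finset.mul_sum]
    exact Finset.sum_comm
  simp_rw [h1]
  refine tendsto_finsetSum _ fun m _ => Tendsto.const_mul _ ?_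
  rw [← D.sum_lam_zero_pow]
  exact (D.continuous_sum_lam_pow m).tendsto 0

lemma p_le_one (i : n) : D.p i ≤ 1 := by
  rw [← D.sum_p]
  exact Finset.single_le_sum (fun i _ => D.p_nonneg i) (Finset.mem_univ i)

/-- The eigenvalues of `ρ ^ (1 / 2) σ ^ s ρ ^ (1 / 2)` tend to those of `ρ`, in the weak sense. -/
lemma tendsto_sum_lam {φ : ℝ → ℝ} (hφ : ContinuousOn φ (Set.Icc 0 2)) :
    Tendsto (fun s => ∑ k, φ (D.lam s k)) (𝓝 0) (𝓝 (∑ i, φ (D.p i))) := by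
  -- The nonnegative eigenvalues have a sum tending to `1`, so near `s = 0` polynomial approximation
  -- on `[0, 2]` covers them all.
  have hbd : ∀ᶠ s in 𝓝 (0 : ℝ), ∀ k, D.lam s k ∈ Set.Icc (0 : ℝ) 2 := by
    have h1 := (D.continuous_sum_lam_pow 1).tendsto 0
    rw [D.sum_lam_zero_pow] at h1
    simp only [pow_one] at h1
    rw [D.sum_p] at h1
    filter_upwards [h1.eventually (gt_mem_nhds (one_lt_two))] with s hs k
    exact ⟨D.lam_nonneg s k, (Finset.single_le_sum (fun k _ => D.lam_nonneg s k)
      (Finset.mem_univ k)).trans hs.le⟩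
  rw [Metric.tendsto_nhds]
  intro ε hε
  set N : ℝ := ((Fintype.card n : ℕ) : ℝ) with hN
  have hN0 : 0 ≤ N := Nat.cast_nonneg _
  set η := ε / (2 * (N + 1)) with hη
  have hη0 : 0 < η := by positivity
  obtain ⟨r, hr⟩ := exists_polynomial_near_of_continuousOn 0 2 φ hφ η hη0
  have hclose : ∀ a : n → ℝ, (∀ k, a k ∈ Set.Icc (0 : ℝ) 2) →
      |∑ k, r.eval (a k) - ∑ k, φ (a k)| ≤ N * η := by
    intro a ha
    rw [← Finset.sum_sub_distrib]
    refine (Finset.abs_sum_le_sum_abs _ _).trans ?_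
    refine (Finset.sum_le_sum fun k _ => (hr _ (ha k)).le).trans ?_
    simp [hN]
  have hN1 : 2 * (N * η) + η < ε := by
    have h3 : 2 * (N + 1) * η = ε := by
      rw [hη]
      field_simp
    linarith
  filter_upwards [hbd, (Metric.tendsto_nhds.mp (D.tendsto_sum_polynomial_lam r)) η hη0]
    with s hs1 hs2
  have h1 := abs_le.mp (hclose _ hs1)
  have h2 := abs_le.mp (hclose _ fun i => ⟨D.p_nonneg i, (D.p_le_one i).trans one_le_two⟩)
  rw [Real.dist_eq, abs_lt] at hs2 ⊢
  constructor <;> linarith [h1.1, h1.2, h2.1, h2.2, hs2.1, hs2.2]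

lemma A_eq_sum_exp {i : n} (hi : D.p i ≠ 0) (s : ℝ) :
    D.A s i = ∑ j, D.w i j * Real.exp (s * Real.log (D.q j)) := by
  refine Finset.sum_congr rfl fun j _ => ?_
  by_cases hj : D.w i j = 0
  · simp [hj]
  · rw [srpow_of_pos (D.q_pos hi hj), Real.rpow_def_of_pos (D.q_pos hi hj), mul_comm s]

lemma hasDerivAt_sum_lam :
    HasDerivAt (fun s => ∑ k, D.lam s k) (∑ i, D.p i * D.L i) 0 := by
  simp_rw [D.sum_lam]
  apply HasDerivAt.fun_sum
  intro i _
  by_cases hi : D.p i = 0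
  · simp only [hi, zero_mul]
    exact hasDerivAt_const _ _
  refine HasDerivAt.const_mul _ ?_
  have hA : (fun s => D.A s i) = fun s => ∑ j, D.w i j * Real.exp (s * Real.log (D.q j)) :=
    funext (D.A_eq_sum_exp hi)
  rw [hA, L]
  apply HasDerivAt.fun_sum
  intro j _
  have := (((hasDerivAt_id (0 : ℝ)).mul_const (Real.log (D.q j))).exp).const_mul (D.w i j)
  simpa using this

lemma sum_lam_zero : ∑ k, D.lam 0 k = 1 := by
  have := D.sum_lam_zero_pow 1
  simp only [pow_one] at this
  rw [this, D.sum_p]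

/-- Difference quotients of the convex function `δ ↦ x ^ (1 + δ)` at `0` increase with `δ`; this is
Bernoulli's inequality with exponent `δ / η ≤ 1`. -/
lemma rpow_sub_self_div_le {x δ η : ℝ} (hx : 0 ≤ x) (hδ : 0 < δ) (hη : δ ≤ η) :
    (x ^ (1 + δ) - x) / δ ≤ (x ^ (1 + η) - x) / η := by
  have hη0 : 0 < η := hδ.trans_le hη
  rcases hx.eq_or_lt with h0 | h0
  · rw [← h0, Real.zero_rpow (by linarith), Real.zero_rpow (by linarith)]
    simp
  have hb := rpow_one_add_le_one_add_mul_self (s := x ^ η - 1)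
    (by linarith [Real.rpow_nonneg hx η]) (p := δ / η) (by positivity)
    ((div_le_one hη0).mpr hη)
  rw [add_sub_cancel, ← Real.rpow_mul hx, mul_div_cancel₀ _ hη0.ne'] at hb
  rw [Real.rpow_add h0, Real.rpow_add h0, Real.rpow_one, div_le_div_iff₀ hδ hη0]
  have h1 : x ^ δ - 1 ≤ δ / η * (x ^ η - 1) := by linarith
  have h2 : (x ^ δ - 1) * η ≤ δ * (x ^ η - 1) := by
    calc (x ^ δ - 1) * η ≤ δ / η * (x ^ η - 1) * η := mul_le_mul_of_nonneg_right h1 hη0.le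
      _ = _ := by field_simp
  nlinarith [mul_le_mul_of_nonneg_left h2 hx]

lemma tendsto_one_sub_div : Tendsto (fun α : ℝ => (1 - α) / α) (𝓝[>] 1) (𝓝[≠] 0) := by
  refine tendsto_nhdsWithin_iff.mpr ⟨?_, ?_⟩
  · have : ContinuousAt (fun α : ℝ => (1 - α) / α) 1 :=
      (continuousAt_const.sub continuousAt_id).div continuousAt_id one_ne_zero
    have h := this.tendsto
    simp only [sub_self, zero_div] at h
    exact h.mono_left nhdsWithin_le_nhds
  · filter_upwards [self_mem_nhdsWithin] with α hα
    have hα' : (1 : ℝ) < α := hα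
    exact div_ne_zero (by linarith) (by linarith)

lemma tendsto_sum_lam_slope :
    Tendsto (fun α : ℝ => (∑ k, D.lam ((1 - α) / α) k - 1) / (α - 1)) (𝓝[>] 1)
      (𝓝 (-∑ i, D.p i * D.L i)) := by
  have h1 := D.hasDerivAt_sum_lam.tendsto_slope.comp tendsto_one_sub_div
  have h2 : Tendsto (fun α : ℝ => -α⁻¹) (𝓝[>] 1) (𝓝 (-1)) := by
    have : ContinuousAt (fun α : ℝ => -α⁻¹) 1 := (continuousAt_inv₀ one_ne_zero).neg
    have h := this.tendsto
    rw [inv_one] at h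
    exact h.mono_left nhdsWithin_le_nhds
  have h3 := h1.mul h2
  rw [mul_neg_one] at h3
  refine h3.congr' ?_
  filter_upwards [self_mem_nhdsWithin] with α hα
  have hα' : (1 : ℝ) < α := hα
  have e1 : α ≠ 0 := by linarith
  have e2 : α - 1 ≠ 0 := by linarith
  have e3 : 1 - α ≠ 0 := by linarith
  simp only [Function.comp_apply, slope_def_field, D.sum_lam_zero, sub_zero]
  field_simp
  ring

/-- After `log t ≤ t - 1`, the trace splits into a linear part, differentiable in `s`, and a
remainder whose exponent is frozen at `1 + η`. Only weak convergence of the spectrum is then needed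
for the remainder. -/
lemma sandwichedFormula_le {α η : ℝ} (hα : 1 < α) (hη : α - 1 ≤ η) :
    sandwichedFormula ρ σ α ≤ (∑ k, D.lam ((1 - α) / α) k - 1) / (α - 1)
      + ∑ k, (D.lam ((1 - α) / α) k ^ (1 + η) - D.lam ((1 - α) / α) k) / η := by
  have hδ : 0 < α - 1 := by linarith
  have h1 : Real.log (D.trSandwich α) ≤ D.trSandwich α - 1 :=
    Real.log_le_sub_one_of_pos (D.trSandwich_pos hα)
  have h2 : ∑ k, (D.lam ((1 - α) / α) k ^ α - D.lam ((1 - α) / α) k) / (α - 1)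
      ≤ ∑ k, (D.lam ((1 - α) / α) k ^ (1 + η) - D.lam ((1 - α) / α) k) / η := by
    refine Finset.sum_le_sum fun k _ => ?_
    have := rpow_sub_self_div_le (D.lam_nonneg ((1 - α) / α) k) hδ hη
    rwa [add_sub_cancel] at this
  refine le_trans ?_ (add_le_add_right h2 _)
  rw [D.sandwichedFormula_eq, ← Finset.sum_div, ← add_div, one_div, ← div_eq_inv_mul]
  refine (div_le_div_iff_of_pos_right hδ).mpr (h1.trans (le_of_eq ?_))
  rw [Finset.sum_sub_distrib, trSandwich]
  simp_rw [srpow_eq_rpow (by linarith : 0 < α)]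
  ring

lemma tendsto_sum_p_rpow :
    Tendsto (fun η : ℝ => ∑ i, (D.p i ^ (1 + η) - D.p i) / η) (𝓝[>] 0)
      (𝓝 (∑ i, D.p i * Real.log (D.p i))) := by
  refine tendsto_finsetSum _ fun i _ => ?_
  by_cases hi : D.p i = 0
  · rw [hi, zero_mul]
    refine tendsto_const_nhds.congr' ?_
    filter_upwards [self_mem_nhdsWithin] with η hη
    have hη' : (0 : ℝ) < η := hη
    rw [Real.zero_rpow (by linarith)]
    simp
  · have hp := D.p_pos hi
    have hd : HasDerivAt (fun η : ℝ => D.p i ^ (1 + η)) (D.p i * Real.log (D.p i)) 0 := by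
      have := ((hasDerivAt_id (0 : ℝ)).const_add 1).const_rpow hp
      simpa [mul_comm] using this
    refine (hd.tendsto_slope.mono_left (nhdsWithin_mono _ fun x hx => ne_of_gt hx)).congr fun η => ?_
    simp [slope_def_field]

lemma tendsto_sandwichedFormula (D : SpectralPair ρ σ) :
    Tendsto (sandwichedFormula ρ σ) (𝓝[>] 1) (𝓝 (relEntropy ρ σ)) := by
  refine tendsto_order.mpr ⟨fun a ha => ?_, fun b hb => ?_⟩
  · filter_upwards [self_mem_nhdsWithin] with α hα
    exact ha.trans_le (D.relEntropy_le_sandwichedFormula hα)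
  · have h1 := D.tendsto_sum_p_rpow.const_add (-∑ i, D.p i * D.L i)
    have hS : -∑ i, D.p i * D.L i + ∑ i, D.p i * Real.log (D.p i) = relEntropy ρ σ := by
      rw [D.relEntropy_eq_sum_p, neg_add_eq_sub, ← Finset.sum_sub_distrib]
      exact Finset.sum_congr rfl fun i _ => by ring
    rw [hS] at h1
    -- The exponent `η` is fixed first, so that the limit in `α` of the upper bound already lies
    -- below `b`.
    obtain ⟨η, hηb, hη⟩ := ((h1.eventually (gt_mem_nhds hb)).and self_mem_nhdsWithin).exists
    have hη0 : (0 : ℝ) < η := hη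
    have h2 := D.tendsto_sum_lam (φ := fun x => (x ^ (1 + η) - x) / η)
      (((Real.continuous_rpow_const (by linarith : (0 : ℝ) ≤ 1 + η)).sub
        continuous_id).div_const η).continuousOn
    have h3 := D.tendsto_sum_lam_slope.add
      (h2.comp (tendsto_one_sub_div.mono_right nhdsWithin_le_nhds))
    filter_upwards [h3.eventually (gt_mem_nhds hηb), self_mem_nhdsWithin,
      Ioo_mem_nhdsGT (by linarith : (1 : ℝ) < 1 + η)] with α h4 h5 h6
    exact (D.sandwichedFormula_le h5 (by linarith [h6.2])).trans_lt h4

/-! ### The derivative of the sandwiched quantity at `1`. -/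

/-- The variance of `ln σ` in the `i`-th eigenvector of `ρ`. -/
def V (i : n) : ℝ := ∑ j, D.w i j * (Real.log (D.q j) - D.L i) ^ 2

lemma V_nonneg (i : n) : 0 ≤ D.V i :=
  Finset.sum_nonneg fun j _ => mul_nonneg (D.w_nonneg i j) (sq_nonneg _)

lemma exp_Z_eq {α : ℝ} (hα : 0 < α) {i : n} (hi : D.p i ≠ 0) :
    Real.exp (D.Z α i) = Real.exp ((α - 1) * (Real.log (D.p i) - D.L i))
      * (D.A ((1 - α) / α) i * Real.exp (-((1 - α) / α * D.L i))) ^ α := by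
  have hA := A_pos hi ((1 - α) / α)
  rw [Real.mul_rpow hA.le (Real.exp_pos _).le, Real.rpow_def_of_pos hA, ← Real.exp_mul,
    ← Real.exp_add, ← Real.exp_add, Z]
  congr 1
  field_simp
  ring

lemma eventually_sq_le_A {i : n} (hi : D.p i ≠ 0) : ∀ᶠ s in 𝓝 (0 : ℝ),
    1 + s ^ 2 * (D.V i / 4) ≤ D.A s i * Real.exp (-(s * D.L i)) := by
  have h := eventually_one_add_sq_le_sum_exp (x := fun j => Real.log (D.q j)) (D.w_nonneg i)
    (D.sum_w_right i)
  filter_upwards [h] with s hs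
  refine hs.trans (le_of_eq ?_)
  rw [D.A_eq_sum_exp hi, Finset.sum_mul]
  refine Finset.sum_congr rfl fun j _ => ?_
  rw [mul_assoc, ← Real.exp_add, ← L]
  ring_nf

/-- A strengthening of `le_Z` by the variance of `ln σ`. The `32` collects the `4` of the quadratic
Jensen bound, the `4` in `s ^ 2 ≥ (α - 1) ^ 2 / 4` for `α < 2`, and the `2` from an exponential
factor above `1 / 2`. -/
lemma eventually_sq_le_exp_Z (i : n) (S : ℝ) : ∀ᶠ α in 𝓝[>] (1 : ℝ),
    D.p i * Real.exp ((α - 1) * (Real.log (D.p i) - D.L i - S))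
      + (α - 1) ^ 2 * (D.p i * D.V i / 32)
      ≤ D.p i * Real.exp (D.Z α i - (α - 1) * S) := by
  by_cases hi : D.p i = 0
  · simp [hi]
  have hsub : Tendsto (fun α : ℝ => Real.exp ((α - 1) * (Real.log (D.p i) - D.L i - S))) (𝓝[>] 1)
      (𝓝 1) := by
    have : Continuous (fun α : ℝ => Real.exp ((α - 1) * (Real.log (D.p i) - D.L i - S))) := by
      fun_prop
    have h := this.tendsto 1
    simp only [sub_self, zero_mul, Real.exp_zero] at h
    exact h.mono_left nhdsWithin_le_nhds
  filter_upwards [hsub.eventually (lt_mem_nhds (by norm_num : (1 / 2 : ℝ) < 1)),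
    (tendsto_one_sub_div.mono_right nhdsWithin_le_nhds).eventually (D.eventually_sq_le_A hi),
    Ioo_mem_nhdsGT (one_lt_two (α := ℝ))] with α h1 h2 h3
  obtain ⟨h3, h4⟩ := h3
  have h0 : 0 < α := by linarith
  set y := Real.log (D.p i) - D.L i - S with hy
  set s := (1 - α) / α with hs
  have hV := D.V_nonneg i
  have hs2 : (α - 1) ^ 2 / 4 ≤ s ^ 2 := by
    rw [hs, div_pow, div_le_div_iff₀ (by norm_num) (by positivity)]
    have : α ^ 2 ≤ 4 := by nlinarith
    nlinarith [mul_le_mul_of_nonneg_left this (sq_nonneg (α - 1))]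
  have hexp : Real.exp (D.Z α i - (α - 1) * S) = Real.exp ((α - 1) * y)
      * (D.A s i * Real.exp (-(s * D.L i))) ^ α := by
    rw [Real.exp_sub, D.exp_Z_eq h0 hi, mul_div_right_comm, ← Real.exp_sub, ← mul_sub]
  have hone : 1 ≤ D.A s i * Real.exp (-(s * D.L i)) :=
    le_trans (le_add_of_nonneg_right (by positivity)) h2
  have hpow : 1 + s ^ 2 * (D.V i / 4) ≤ (D.A s i * Real.exp (-(s * D.L i))) ^ α :=
    h2.trans (Real.self_le_rpow_of_one_le hone h3.le)
  have hkey : Real.exp ((α - 1) * y) + (α - 1) ^ 2 * (D.V i / 32)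
      ≤ Real.exp (D.Z α i - (α - 1) * S) := by
    rw [hexp]
    refine le_trans ?_ (mul_le_mul_of_nonneg_left hpow (Real.exp_pos _).le)
    rw [mul_add, mul_one]
    refine add_le_add le_rfl ?_
    calc (α - 1) ^ 2 * (D.V i / 32) = 1 / 2 * ((α - 1) ^ 2 / 4 * (D.V i / 4)) := by ring
      _ ≤ Real.exp ((α - 1) * y) * (s ^ 2 * (D.V i / 4)) := by gcongr
  calc _ = D.p i * (Real.exp ((α - 1) * y) + (α - 1) ^ 2 * (D.V i / 32)) := by ring
    _ ≤ _ := mul_le_mul_of_nonneg_left hkey (D.p_nonneg i)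

/-- The variance of `X` consists of the variance of the conditional means `Y i` and the mean of the
`V i`. Both enter the quadratic coefficient with positive factors, so both vanish. -/
lemma X_eq_of_deriv_sandwichedFormula (h : DerivTendstoAtOne (sandwichedFormula ρ σ) 0)
    (m : n × n) (hm : D.P m ≠ 0) : D.X m = relEntropy ρ σ := by
  set S := relEntropy ρ σ with hS
  set Y : n → ℝ := fun i => Real.log (D.p i) - D.L i with hY
  have hsub : Tendsto (fun α : ℝ => α - 1) (𝓝[>] 1) (𝓝 0) := by
    have : Tendsto (fun α : ℝ => α - 1) (𝓝 1) (𝓝 (1 - 1)) :=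
      (continuous_id.sub continuous_const).tendsto 1
    rw [sub_self] at this
    exact this.mono_left nhdsWithin_le_nhds
  have hev := hsub.eventually (eventually_one_add_sq_le_sum_exp (x := Y) D.p_nonneg D.sum_p)
  rw [← D.relEntropy_eq_sum_p] at hev
  have hev2 := eventually_all.mpr fun i => D.eventually_sq_le_exp_Z i S
  have hc := h.coeff_nonpos D.tendsto_sandwichedFormula
    (c := (∑ i, D.p i * (Y i - S) ^ 2) / 4 + (∑ i, D.p i * D.V i) / 32) (by
      filter_upwards [hev, hev2, self_mem_nhdsWithin] with α h1 h2 h3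
      have hα : (1 : ℝ) < α := h3
      calc 1 + ((∑ i, D.p i * (Y i - S) ^ 2) / 4 + (∑ i, D.p i * D.V i) / 32) * (α - 1) ^ 2
          ≤ ∑ i, D.p i * Real.exp ((α - 1) * (Y i - S))
            + (α - 1) ^ 2 * ((∑ i, D.p i * D.V i) / 32) := by linarith
        _ = ∑ i, (D.p i * Real.exp ((α - 1) * (Y i - S))
            + (α - 1) ^ 2 * (D.p i * D.V i / 32)) := by
          rw [Finset.sum_add_distrib, ← Finset.mul_sum, ← Finset.sum_div]
        _ ≤ ∑ i, D.p i * Real.exp (D.Z α i - (α - 1) * S) := Finset.sum_le_sum fun i _ => h2 i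
        _ = (∑ i, D.p i * Real.exp (D.Z α i)) * Real.exp (-((α - 1) * S)) := by
          rw [Finset.sum_mul]
          refine Finset.sum_congr rfl fun i _ => ?_
          rw [mul_assoc, ← Real.exp_add, sub_eq_add_neg]
        _ ≤ D.trSandwich α * Real.exp (-((α - 1) * S)) :=
          mul_le_mul_of_nonneg_right (D.sum_exp_Z_le_trSandwich hα) (Real.exp_pos _).le
        _ = _ := by
          rw [← D.exp_sandwichedFormula hα.ne' (D.trSandwich_pos hα), ← Real.exp_add,
            ← hS]
          ring_nf)
  have hn1 : ∀ i, 0 ≤ D.p i * (Y i - S) ^ 2 := fun i => mul_nonneg (D.p_nonneg i) (sq_nonneg _)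
  have hn2 : ∀ i, 0 ≤ D.p i * D.V i := fun i => mul_nonneg (D.p_nonneg i) (D.V_nonneg i)
  have hs1 := Finset.sum_nonneg fun i (_ : i ∈ Finset.univ) => hn1 i
  have hs2 := Finset.sum_nonneg fun i (_ : i ∈ Finset.univ) => hn2 i
  obtain ⟨hi, hj⟩ := D.P_ne_zero hm
  have h1 := (Finset.sum_eq_zero_iff_of_nonneg (fun i _ => hn1 i)).mp
    (le_antisymm (by linarith) hs1) m.1 (Finset.mem_univ _)
  have h2 := (Finset.sum_eq_zero_iff_of_nonneg (fun i _ => hn2 i)).mp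
    (le_antisymm (by linarith) hs2) m.1 (Finset.mem_univ _)
  have h3 : Y m.1 = S :=
    sub_eq_zero.mp (pow_eq_zero_iff two_ne_zero |>.mp ((mul_eq_zero.mp h1).resolve_left hi))
  have h4 := (mul_eq_zero.mp h2).resolve_left hi
  have h5 := (Finset.sum_eq_zero_iff_of_nonneg
    (fun j _ => mul_nonneg (D.w_nonneg m.1 j) (sq_nonneg (Real.log (D.q j) - D.L m.1)))).mp h4 m.2
    (Finset.mem_univ _)
  have h6 := sub_eq_zero.mp
    (pow_eq_zero_iff two_ne_zero |>.mp ((mul_eq_zero.mp h5).resolve_left hj))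
  rw [X, h6]
  exact h3

end SpectralPair

/-! ### From the functions `x / (x + u)` to the logarithm. -/

section LogComparison

variable {ι κ : Type*} [Fintype ι] [Fintype κ] {c x : ι → ℝ} {d y : κ → ℝ}

lemma tendsto_sum_log_add_sub_log (hx : ∀ i, 0 ≤ x i) :
    Tendsto (fun u : ℝ => ∑ i, c i * Real.log (x i + u) - (∑ i, c i) * Real.log u)
      atTop (𝓝 0) := by
  have h1 : Tendsto (fun u : ℝ => ∑ i, c i * Real.log (1 + x i / u)) atTop
      (𝓝 (∑ i, c i * Real.log (1 + 0))) := by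
    refine tendsto_finsetSum _ fun i _ => Tendsto.const_mul _ (Tendsto.log ?_ (by norm_num))
    exact (tendsto_const_nhds.div_atTop tendsto_id).const_add 1
  simp only [add_zero, Real.log_one, mul_zero, Finset.sum_const_zero] at h1
  refine h1.congr' ?_
  filter_upwards [eventually_gt_atTop 0] with u hu
  rw [Finset.sum_mul, ← Finset.sum_sub_distrib]
  refine Finset.sum_congr rfl fun i _ => ?_
  rw [← mul_sub, ← Real.log_div (by linarith [hx i]) hu.ne', add_div, div_self hu.ne', add_comm]

lemma hasDerivAt_sum_log_add (hx : ∀ i, 0 ≤ x i) {u : ℝ} (hu : 0 < u) :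
    HasDerivAt (fun u : ℝ => ∑ i, c i * Real.log (x i + u))
      ((∑ i, c i - ∑ i, c i * (x i / (x i + u))) / u) u := by
  have h : (∑ i, c i - ∑ i, c i * (x i / (x i + u))) / u = ∑ i, c i * (1 / (x i + u)) := by
    rw [← Finset.sum_sub_distrib, Finset.sum_div]
    refine Finset.sum_congr rfl fun i _ => ?_
    have : x i + u ≠ 0 := by linarith [hx i]
    field_simp
    ring
  rw [h]
  apply HasDerivAt.fun_sum
  intro i _
  exact (((hasDerivAt_id u).const_add (x i)).log (by simpa using by linarith [hx i])).const_mul _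

lemma tendsto_sum_log_add (hc : ∀ i, c i ≠ 0 → 0 < x i) :
    Tendsto (fun u : ℝ => ∑ i, c i * Real.log (x i + u)) (𝓝[>] 0)
      (𝓝 (∑ i, c i * Real.log (x i))) := by
  refine tendsto_finsetSum _ fun i _ => ?_
  by_cases hi : c i = 0
  · simp [hi]
  · refine Tendsto.const_mul _ (Tendsto.log ?_ (hc i hi).ne')
    have : Tendsto (fun u : ℝ => x i + u) (𝓝 0) (𝓝 (x i + 0)) :=
      (continuous_const.add continuous_id).tendsto 0
    rw [add_zero] at this
    exact this.mono_left nhdsWithin_le_nhds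

/-- An inequality for the functions `x ↦ x / (x + u)`, `u > 0`, passes to the logarithm. -/
lemma sum_log_le_sum_log_of_resolvent (hx : ∀ i, 0 ≤ x i) (hy : ∀ k, 0 ≤ y k)
    (hc : ∀ i, c i ≠ 0 → 0 < x i) (hd : ∀ k, d k ≠ 0 → 0 < y k) (hcd : ∑ i, c i = ∑ k, d k)
    (h : ∀ u : ℝ, 0 < u → ∑ i, c i * (x i / (x i + u)) ≤ ∑ k, d k * (y k / (y k + u))) :
    ∑ i, c i * Real.log (x i) ≤ ∑ k, d k * Real.log (y k) := by
  -- The hypothesis makes `Φ` nondecreasing, and equal total weights make it tend to `0` at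
  -- infinity. Hence `Φ ≤ 0`, and `u → 0` gives the claim.
  set Φ : ℝ → ℝ := fun u => ∑ i, c i * Real.log (x i + u) - ∑ k, d k * Real.log (y k + u) with hΦ
  have hder : ∀ u ∈ Set.Ioi (0 : ℝ), HasDerivAt Φ
      ((∑ i, c i - ∑ i, c i * (x i / (x i + u))) / u
        - (∑ k, d k - ∑ k, d k * (y k / (y k + u))) / u) u := fun u hu =>
    (hasDerivAt_sum_log_add hx hu).sub (hasDerivAt_sum_log_add hy hu)
  have hmono : MonotoneOn Φ (Set.Ioi 0) := by
    refine monotoneOn_of_deriv_nonneg (convex_Ioi 0)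
      (fun u hu => (hder u hu).continuousAt.continuousWithinAt) ?_ ?_
    · rw [interior_Ioi]
      exact fun u hu => (hder u hu).differentiableAt.differentiableWithinAt
    · rw [interior_Ioi]
      intro u hu
      have hu' : (0 : ℝ) < u := hu
      rw [(hder u hu).deriv, ← sub_div, hcd]
      exact div_nonneg (by linarith [h u hu']) hu'.le
  have htop : Tendsto Φ atTop (𝓝 0) := by
    have := (tendsto_sum_log_add_sub_log (c := c) hx).sub
      (tendsto_sum_log_add_sub_log (c := d) hy)
    rw [sub_zero] at this
    refine this.congr fun u => ?_
    rw [hcd]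
    simp only [hΦ]
    ring
  have hneg : ∀ u, 0 < u → Φ u ≤ 0 := by
    intro u hu
    refine ge_of_tendsto htop ?_
    filter_upwards [eventually_ge_atTop u] with v hv
    exact hmono hu (hu.trans_le hv) hv
  have hzero := (tendsto_sum_log_add hc).sub (tendsto_sum_log_add hd)
  have := le_of_tendsto hzero (by
    filter_upwards [self_mem_nhdsWithin] with u hu
    exact hneg u hu)
  linarith

end LogComparison

/-! ### Hilbert-Schmidt norms, Bessel's inequality and completing squares. -/

section HilbertSchmidt

variable {E : Type*} [NormedAddCommGroup E] [InnerProductSpace ℂ E]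
  {ι : Type*} [Fintype ι]

/-- The Hilbert-Schmidt norm does not depend on the orthonormal basis. -/
lemma sum_norm_sq_apply_eq [FiniteDimensional ℂ E] (T : E →ₗ[ℂ] E) (b : OrthonormalBasis ι ℂ E)
    (c : OrthonormalBasis ι ℂ E) : ∑ i, ‖T (b i)‖ ^ 2 = ∑ i, ‖T (c i)‖ ^ 2 := by
  have key : ∀ a : OrthonormalBasis ι ℂ E, ∑ i, ‖T (a i)‖ ^ 2 = ∑ k, ‖T.adjoint (c k)‖ ^ 2 := by
    intro a
    calc ∑ i, ‖T (a i)‖ ^ 2 = ∑ i, ∑ k, ‖(inner ℂ (c k) (T (a i)) : ℂ)‖ ^ 2 := by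
          simp_rw [c.sum_sq_norm_inner_right]
      _ = ∑ k, ∑ i, ‖(inner ℂ (T.adjoint (c k)) (a i) : ℂ)‖ ^ 2 := by
          rw [Finset.sum_comm]
          simp_rw [LinearMap.adjoint_inner_left]
      _ = _ := by simp_rw [a.sum_sq_norm_inner_left]
  rw [key b, key c]

lemma norm_sq_sum_smul_orthonormalBasis (b : OrthonormalBasis ι ℂ E) (z : ι → ℂ) :
    ‖∑ i, z i • b i‖ ^ 2 = ∑ i, ‖z i‖ ^ 2 := by
  rw [← b.sum_sq_norm_inner_right]
  simp_rw [b.orthonormal.inner_right_fintype]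

/-- Bessel's inequality for an orthogonal family, normalised in the inequality. -/
lemma sum_inv_mul_norm_inner_sq_le [DecidableEq ι] {v : ι → E} {a : ι → ℝ} (ha : ∀ i, 0 ≤ a i)
    (hv : ∀ i j, inner ℂ (v i) (v j) = if i = j then (a i : ℂ) else 0) (z : E) :
    ∑ i, (a i)⁻¹ * ‖(inner ℂ (v i) z : ℂ)‖ ^ 2 ≤ ‖z‖ ^ 2 := by
  -- Indices with `a i = 0` are dropped: their terms vanish because the inverse of zero is zero.
  set v' : {i // a i ≠ 0} → E := fun i => ((√(a i))⁻¹ : ℂ) • v i with hv'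
  have hon : Orthonormal ℂ v' := by
    rw [orthonormal_iff_ite]
    intro i j
    simp only [hv', inner_smul_left, inner_smul_right, hv, Subtype.ext_iff]
    split_ifs with hij
    · rw [← hij, map_inv₀, Complex.conj_ofReal, ← mul_assoc, ← mul_inv, ← Complex.ofReal_mul,
        Real.mul_self_sqrt (ha _), inv_mul_cancel₀ (by exact_mod_cast i.2)]
    · simp
  have h := hon.sum_inner_products_le (s := Finset.univ) z
  refine le_trans (le_of_eq ?_) h
  have h0 : ∀ i : {i // a i ≠ 0}, ‖(inner ℂ (v' i) z : ℂ)‖ ^ 2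
      = (a i)⁻¹ * ‖(inner ℂ (v i) z : ℂ)‖ ^ 2 := by
    intro i
    simp only [hv', inner_smul_left]
    rw [map_inv₀, Complex.conj_ofReal, norm_mul, mul_pow, norm_inv, Complex.norm_real,
      Real.norm_of_nonneg (Real.sqrt_nonneg _), inv_pow, Real.sq_sqrt (ha _)]
  simp_rw [h0]
  rw [← Finset.sum_subtype (p := fun i => a i ≠ 0) (Finset.univ.filter fun i => a i ≠ 0)
    (by simp) (fun i => (a i)⁻¹ * ‖(inner ℂ (v i) z : ℂ)‖ ^ 2)]
  refine (Finset.sum_filter_of_ne (p := fun i => a i ≠ 0) fun i _ hi h0 => hi ?_).symm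
  rw [h0, inv_zero, zero_mul]

/-- A two-fold completion of the square. -/
lemma two_mul_re_inner_sub_le {v k y : E} (hky : (inner ℂ v k : ℂ).re = (inner ℂ y v : ℂ).re)
    {a u : ℝ} (ha : 0 < a) (hu : 0 < u) :
    2 * (inner ℂ v k : ℂ).re - ‖k‖ ^ 2 - u * (a⁻¹ * ‖y‖ ^ 2) ≤ ‖v‖ ^ 2 * (a / (a + u)) := by
  have h1 : (inner ℂ v k : ℂ).re ≤ ‖v‖ * ‖k‖ :=
    (Complex.re_le_norm _).trans (norm_inner_le_norm _ _)
  have h2 : (inner ℂ v k : ℂ).re ≤ ‖y‖ * ‖v‖ := by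
    rw [hky]
    exact (Complex.re_le_norm _).trans (norm_inner_le_norm _ _)
  set τ := (inner ℂ v k : ℂ).re
  -- The term `2 * τ` is split in these proportions; one share completes the square with `‖k‖`, the
  -- other with `‖y‖`.
  have e1 : a / (a + u) + u / (a + u) = 1 := by field_simp
  have p1 : 0 < a / (a + u) := by positivity
  have p2 : 0 < u / (a + u) := by positivity
  have h3 : 2 * (a / (a + u)) * τ - ‖k‖ ^ 2 ≤ (a / (a + u)) ^ 2 * ‖v‖ ^ 2 := by
    nlinarith [mul_le_mul_of_nonneg_left h1 p1.le, sq_nonneg (a / (a + u) * ‖v‖ - ‖k‖)]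
  have h4 : 2 * (u / (a + u)) * τ - u * (a⁻¹ * ‖y‖ ^ 2) ≤ a * u / (a + u) ^ 2 * ‖v‖ ^ 2 := by
    have h5 : a * u / (a + u) ^ 2 * ‖v‖ ^ 2 + u * (a⁻¹ * ‖y‖ ^ 2)
        - 2 * (u / (a + u)) * (‖y‖ * ‖v‖) = u / a * (a / (a + u) * ‖v‖ - ‖y‖) ^ 2 := by
      field_simp
      ring
    have h6 : 0 ≤ u / a * (a / (a + u) * ‖v‖ - ‖y‖) ^ 2 := by positivity
    nlinarith [mul_le_mul_of_nonneg_left h2 p2.le]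
  have h7 : (a / (a + u)) ^ 2 * ‖v‖ ^ 2 + a * u / (a + u) ^ 2 * ‖v‖ ^ 2
      = ‖v‖ ^ 2 * (a / (a + u)) := by
    field_simp
  have h8 : 2 * τ = 2 * (a / (a + u)) * τ + 2 * (u / (a + u)) * τ := by
    linear_combination (-2 * τ) * e1
  linarith

end HilbertSchmidt

/-- The equality case of Peierls' inequality. -/
lemma IsEigenbasis.isEigenbasis_of_sum_le {A : Matrix n n ℂ}
    {b : OrthonormalBasis n ℂ (EuclideanSpace ℂ n)} {a : n → ℝ}
    (h : IsEigenbasis A b a) (ha : ∀ i, 0 ≤ a i) {φ : ℝ → ℝ}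
    (hφ : StrictConvexOn ℝ (Set.Ici 0) φ) (g : OrthonormalBasis n ℂ (EuclideanSpace ℂ n))
    (hle : ∑ i, φ (a i) ≤ ∑ k, φ (inner ℂ (g k) (op A (g k)) : ℂ).re) :
    IsEigenbasis A g (fun k => (inner ℂ (g k) (op A (g k)) : ℂ).re) := by
  have hw1 : ∀ k, ∑ i, ‖(inner ℂ (b i) (g k) : ℂ)‖ ^ 2 = 1 := fun k => by
    rw [b.sum_sq_norm_inner_right, g.orthonormal.1 k, one_pow]
  have h1 : ∀ k, φ (inner ℂ (g k) (op A (g k)) : ℂ).re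
      ≤ ∑ i, ‖(inner ℂ (b i) (g k) : ℂ)‖ ^ 2 * φ (a i) := by
    intro k
    rw [h.re_inner_op_self]
    have := hφ.convexOn.map_sum_le (t := Finset.univ)
      (w := fun i => ‖(inner ℂ (b i) (g k) : ℂ)‖ ^ 2)
      (p := a) (fun i _ => sq_nonneg _) (hw1 k) (fun i _ => ha i)
    simpa [smul_eq_mul, mul_comm] using this
  have h2 : ∑ k, ∑ i, ‖(inner ℂ (b i) (g k) : ℂ)‖ ^ 2 * φ (a i) = ∑ i, φ (a i) := by
    rw [Finset.sum_comm]
    refine Finset.sum_congr rfl fun i _ => ?_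
    rw [← Finset.sum_mul, g.sum_sq_norm_inner_left, b.orthonormal.1 i, one_pow, one_mul]
  have h3 := (Finset.sum_eq_sum_iff_of_le fun k _ => h1 k).mp
    (le_antisymm (Finset.sum_le_sum fun k _ => h1 k) (h2.le.trans hle))
  intro k
  have h4 := h3 k (Finset.mem_univ k)
  rw [h.re_inner_op_self] at h4
  -- By strict convexity, all eigenvalues whose eigenvectors overlap with `g k` coincide with their
  -- mean.
  have h5 := (hφ.map_sum_eq_iff' (t := Finset.univ)
    (w := fun i => ‖(inner ℂ (b i) (g k) : ℂ)‖ ^ 2) (p := a) (fun i _ => sq_nonneg _) (hw1 k)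
    (fun i _ => ha i)).mp (by simpa [smul_eq_mul, mul_comm] using h4)
  rw [h.op_apply]
  conv_rhs => rw [← b.sum_repr' (g k), Finset.smul_sum]
  refine Finset.sum_congr rfl fun i _ => ?_
  rw [smul_smul]
  by_cases h0 : (inner ℂ (b i) (g k) : ℂ) = 0
  · simp [h0]
  · have h6 := h5 i (Finset.mem_univ i) (by simpa using h0)
    congr 2
    beta_reduce
    rw [h.re_inner_op_self, h6]
    simp [smul_eq_mul, mul_comm]

lemma srpow_half_mul_self {x : ℝ} (hx : 0 ≤ x) (s : ℝ) :
    srpow (s / 2) x * srpow (s / 2) x = srpow s x := by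
  rcases hx.eq_or_lt with h0 | h0
  · rw [← h0]; simp [srpow_zero]
  · rw [srpow_of_pos h0, srpow_of_pos h0, ← Real.rpow_add h0, add_halves]

/-! ### The variational bound and sandwiched orders below `1`. -/

namespace SpectralPair

variable {ρ σ : Matrix n n ℂ} (D : SpectralPair ρ σ)

/-- The operator `σ ^ (s / 2)`. -/
def C (_ : SpectralPair ρ σ) (s : ℝ) : EuclideanSpace ℂ n →ₗ[ℂ] EuclideanSpace ℂ n :=
  op (suppPow σ (s / 2))

lemma inner_C_left (s : ℝ) (x y : EuclideanSpace ℂ n) :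
    inner ℂ (D.C s x) y = inner ℂ x (D.C s y) :=
  inner_op_left (isHermitian_suppPow _ _) x y

lemma C_f (s : ℝ) (j : n) : D.C s (D.f j) = (srpow (s / 2) (D.q j) : ℂ) • D.f j :=
  D.hf.suppPow _ j

lemma C_C (s : ℝ) (x : EuclideanSpace ℂ n) : D.C s (D.C s x) = op (suppPow σ s) x := by
  unfold C
  rw [← op_mul, D.hf.suppPow_mul_suppPow D.q_nonneg, add_halves]

/-- The vectors `σ ^ (s / 2) ρ ^ (1 / 2) g k` are orthogonal with squared norms `lam s k`, which
permits Bessel's inequality in `sum_inv_lam_mul_le`. -/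
lemma inner_C_R_g (s : ℝ) (k l : n) :
    inner ℂ (D.C s (D.R (D.g s k))) (D.C s (D.R (D.g s l)))
      = if k = l then (D.lam s k : ℂ) else 0 := by
  rw [D.inner_C_left, D.C_C, ← D.inner_sandwich, D.isEigenbasis_g s l, inner_smul_right,
    orthonormal_iff_ite.mp (D.g s).orthonormal k l]
  split_ifs with h
  · rw [h, mul_one]
  · rw [mul_zero]

/-- The weights of the eigenvectors of `ρ ^ (1 / 2) σ ^ s ρ ^ (1 / 2)` in the state `ρ`. -/
def weight (s : ℝ) (k : n) : ℝ := ‖D.R (D.g s k)‖ ^ 2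

/-- The matrix entries of the test operator in the variational bound. -/
def testCoeff (s u : ℝ) (i j : n) : ℂ :=
  ((srpow (s / 2) (D.q j) * D.p i / (D.p i * srpow s (D.q j) + u) : ℝ) : ℂ)
    * inner ℂ (D.f j) (D.e i)

/-- The test operator in the variational bound. -/
def testOp (s u : ℝ) : EuclideanSpace ℂ n →ₗ[ℂ] EuclideanSpace ℂ n :=
  D.e.toBasis.constr ℂ fun i => ∑ j, D.testCoeff s u i j • D.f j

lemma testOp_e (s u : ℝ) (i : n) :
    D.testOp s u (D.e i) = ∑ j, D.testCoeff s u i j • D.f j := by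
  have := D.e.toBasis.constr_basis ℂ (fun i => ∑ j, D.testCoeff s u i j • D.f j) i
  rwa [D.e.coe_toBasis] at this

lemma C_testOp_e (s u : ℝ) (i : n) : D.C s (D.testOp s u (D.e i))
    = ∑ j, ((D.p i * srpow s (D.q j) / (D.p i * srpow s (D.q j) + u) : ℝ) : ℂ)
      • (inner ℂ (D.f j) (D.e i) • D.f j) := by
  rw [testOp_e, map_sum]
  refine Finset.sum_congr rfl fun j _ => ?_
  rw [map_smul, D.C_f, smul_smul, smul_smul, testCoeff, ← srpow_half_mul_self (D.q_nonneg j) s]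
  congr 1
  push_cast
  ring

lemma norm_sq_testOp_e (s u : ℝ) (i : n) : ‖D.testOp s u (D.e i)‖ ^ 2
    = ∑ j, D.w i j * (srpow s (D.q j) * D.p i ^ 2 / (D.p i * srpow s (D.q j) + u) ^ 2) := by
  rw [testOp_e, norm_sq_sum_smul_orthonormalBasis]
  refine Finset.sum_congr rfl fun j _ => ?_
  rw [testCoeff, norm_mul, mul_pow, Complex.norm_real, Real.norm_eq_abs, sq_abs, w,
    norm_inner_symm, div_pow, mul_pow, sq (srpow (s / 2) (D.q j)),
    srpow_half_mul_self (D.q_nonneg j)]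
  ring

lemma norm_sq_C_testOp_e (s u : ℝ) (i : n) : ‖D.C s (D.testOp s u (D.e i))‖ ^ 2
    = ∑ j, D.w i j
      * (D.p i * srpow s (D.q j) / (D.p i * srpow s (D.q j) + u)) ^ 2 := by
  rw [C_testOp_e]
  simp_rw [smul_smul]
  rw [norm_sq_sum_smul_orthonormalBasis]
  refine Finset.sum_congr rfl fun j _ => ?_
  rw [norm_mul, mul_pow, Complex.norm_real, Real.norm_eq_abs, sq_abs, w, norm_inner_symm]
  ring

lemma re_inner_C_testOp_e (s u : ℝ) (i : n) :
    (inner ℂ (D.e i) (D.C s (D.testOp s u (D.e i))) : ℂ).re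
    = ∑ j, D.w i j
      * (D.p i * srpow s (D.q j) / (D.p i * srpow s (D.q j) + u)) := by
  rw [C_testOp_e, inner_sum, Complex.re_sum]
  refine Finset.sum_congr rfl fun j _ => ?_
  rw [inner_smul_right, inner_smul_right, Complex.re_ofReal_mul, ← inner_conj_symm (D.e i),
    Complex.mul_conj', w, norm_inner_symm, mul_comm]
  congr 1
  norm_cast

lemma sum_re_inner_R_C_testOp (s u : ℝ) :
    ∑ k, (inner ℂ (D.R (D.g s k)) (D.C s (D.testOp s u (D.R (D.g s k)))) : ℂ).re
      = ∑ i, D.p i * (inner ℂ (D.e i) (D.C s (D.testOp s u (D.e i))) : ℂ).re := by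
  set T := D.R ∘ₗ D.C s ∘ₗ D.testOp s u ∘ₗ D.R with hT
  have h1 : ∀ x, inner ℂ (D.R x) (D.C s (D.testOp s u (D.R x))) = inner ℂ x (T x) := fun x => by
    rw [D.inner_R_left]
    rfl
  have h2 : ∑ k, inner ℂ (D.g s k) (T (D.g s k)) = ∑ i, inner ℂ (D.e i) (T (D.e i)) := by
    rw [← LinearMap.trace_eq_sum_inner, ← LinearMap.trace_eq_sum_inner]
  simp_rw [h1]
  rw [← Complex.re_sum, h2, Complex.re_sum]
  refine Finset.sum_congr rfl fun i _ => ?_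
  rw [← h1, D.R_e, map_smul, map_smul, inner_smul_left, inner_smul_right, Complex.conj_ofReal,
    ← mul_assoc, ← Complex.ofReal_mul, Real.mul_self_sqrt (D.p_nonneg i), Complex.re_ofReal_mul]

lemma sum_norm_sq_R_C_testOp (s u : ℝ) :
    ∑ k, ‖D.C s (D.testOp s u (D.R (D.g s k)))‖ ^ 2
      = ∑ i, D.p i * ‖D.C s (D.testOp s u (D.e i))‖ ^ 2 := by
  have := sum_norm_sq_apply_eq (D.C s ∘ₗ D.testOp s u ∘ₗ D.R) (D.g s) D.e
  simp only [LinearMap.comp_apply] at this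
  rw [this]
  refine Finset.sum_congr rfl fun i _ => ?_
  rw [D.R_e, map_smul, map_smul, norm_smul, mul_pow, Complex.norm_real,
    Real.norm_of_nonneg (Real.sqrt_nonneg _), Real.sq_sqrt (D.p_nonneg i)]

lemma sum_inv_lam_mul_le (s u : ℝ) :
    ∑ k, (D.lam s k)⁻¹ * ‖(D.testOp s u).adjoint (D.C s (D.R (D.g s k)))‖ ^ 2
      ≤ ∑ i, ‖D.testOp s u (D.e i)‖ ^ 2 := by
  have h1 : ∀ k, ‖(D.testOp s u).adjoint (D.C s (D.R (D.g s k)))‖ ^ 2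
      = ∑ i, ‖(inner ℂ (D.C s (D.R (D.g s k))) (D.testOp s u (D.e i)) : ℂ)‖ ^ 2 := by
    intro k
    rw [← D.e.sum_sq_norm_inner_left]
    simp_rw [LinearMap.adjoint_inner_left]
  simp_rw [h1, Finset.mul_sum]
  rw [Finset.sum_comm]
  exact Finset.sum_le_sum fun i _ =>
    sum_inv_mul_norm_inner_sq_le (D.lam_nonneg s) (D.inner_C_R_g s) _

/-- The comparison of the spectra of `ρ` and `σ ^ s` with that of `ρ ^ (1 / 2) σ ^ s ρ ^ (1 / 2)`,
in the state `ρ`, for the functions `x ↦ x / (x + u)`. -/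
lemma resolvent_le (s : ℝ) {u : ℝ} (hu : 0 < u) :
    ∑ m, D.P m * (D.p m.1 * srpow s (D.q m.2) / (D.p m.1 * srpow s (D.q m.2) + u))
      ≤ ∑ k, D.weight s k * (D.lam s k / (D.lam s k + u)) := by
  -- The right side is a concave quadratic functional of the test operator. The coefficients of
  -- `testOp` maximise it entry by entry, and the left side is the maximum.
  have hLHS : ∑ m, D.P m * (D.p m.1 * srpow s (D.q m.2) / (D.p m.1 * srpow s (D.q m.2) + u))
      = 2 * ∑ i, D.p i * (inner ℂ (D.e i) (D.C s (D.testOp s u (D.e i))) : ℂ).re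
        - ∑ i, D.p i * ‖D.C s (D.testOp s u (D.e i))‖ ^ 2
        - u * ∑ i, ‖D.testOp s u (D.e i)‖ ^ 2 := by
    rw [Fintype.sum_prod_type, Finset.mul_sum, Finset.mul_sum, ← Finset.sum_sub_distrib,
      ← Finset.sum_sub_distrib]
    refine Finset.sum_congr rfl fun i _ => ?_
    rw [D.re_inner_C_testOp_e, D.norm_sq_C_testOp_e, D.norm_sq_testOp_e, Finset.mul_sum,
      Finset.mul_sum, Finset.mul_sum, Finset.mul_sum, ← Finset.sum_sub_distrib,
      ← Finset.sum_sub_distrib]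
    refine Finset.sum_congr rfl fun j _ => ?_
    have hb := srpow_nonneg (D.q_nonneg j) s
    have hpb := mul_nonneg (D.p_nonneg i) hb
    have : D.p i * srpow s (D.q j) + u ≠ 0 := by linarith
    simp only [P]
    field_simp
    ring
  -- The same functional is now expanded in the basis `g`, with Bessel's inequality for its last
  -- term, and bounded term by term.
  have hk : ∀ k, 2 * (inner ℂ (D.R (D.g s k)) (D.C s (D.testOp s u (D.R (D.g s k)))) : ℂ).re
      - ‖D.C s (D.testOp s u (D.R (D.g s k)))‖ ^ 2
      - u * ((D.lam s k)⁻¹ * ‖(D.testOp s u).adjoint (D.C s (D.R (D.g s k)))‖ ^ 2)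
      ≤ D.weight s k * (D.lam s k / (D.lam s k + u)) := by
    intro k
    rcases (D.lam_nonneg s k).eq_or_lt with h0 | h0
    · have h1 : D.C s (D.R (D.g s k)) = 0 := by
        have := D.inner_C_R_g s k k
        rw [if_pos rfl, ← h0, Complex.ofReal_zero] at this
        exact inner_self_eq_zero.mp this
      have h2 : (inner ℂ (D.R (D.g s k)) (D.C s (D.testOp s u (D.R (D.g s k)))) : ℂ) = 0 := by
        rw [← D.inner_C_left, h1, inner_zero_left]
      rw [h2, ← h0]
      simp
    · refine two_mul_re_inner_sub_le ?_ h0 hu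
      rw [← D.inner_C_left, ← LinearMap.adjoint_inner_left]
  have hsum := Finset.sum_le_sum fun k (_ : k ∈ Finset.univ) => hk k
  rw [Finset.sum_sub_distrib, Finset.sum_sub_distrib, ← Finset.mul_sum, ← Finset.mul_sum,
    D.sum_re_inner_R_C_testOp, D.sum_norm_sq_R_C_testOp] at hsum
  rw [hLHS]
  linarith [mul_le_mul_of_nonneg_left (D.sum_inv_lam_mul_le s u) hu.le]

lemma weight_nonneg (s : ℝ) (k : n) : 0 ≤ D.weight s k := sq_nonneg _

lemma weight_eq (s : ℝ) (k : n) :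
    D.weight s k = (inner ℂ (D.g s k) (op ρ (D.g s k)) : ℂ).re := by
  have h : op ρ (D.g s k) = D.R (D.R (D.g s k)) := by
    unfold R
    rw [← op_mul, D.he.suppPow_mul_suppPow D.p_nonneg, add_halves, D.he.suppPow_one]
  rw [h, ← D.inner_R_left, inner_self_eq_norm_sq_to_K, weight]
  norm_cast

lemma sum_weight (s : ℝ) : ∑ k, D.weight s k = 1 := by
  simp_rw [D.weight_eq]
  rw [← Complex.re_sum, ← trace_eq_sum_inner_op, D.he.trace_re, D.sum_p]

lemma inner_f_R_eq_zero {j : n} (hj : D.q j = 0) (x : EuclideanSpace ℂ n) :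
    inner ℂ (D.f j) (D.R x) = 0 := by
  rw [← D.e.sum_inner_mul_inner]
  refine Finset.sum_eq_zero fun i _ => ?_
  rw [← D.inner_R_left, D.R_e, inner_smul_left, Complex.conj_ofReal]
  by_cases hi : D.p i = 0
  · simp [hi]
  · rw [← inner_conj_symm, D.inner_eq_zero i j hi hj]
    simp

/-- If `lam s k = 0`, then `ρ ^ (1 / 2) g k` is orthogonal to every `f j` with `q j > 0`, and by the
support condition to the others too. -/
lemma lam_pos_of_weight_ne_zero {s : ℝ} {k : n} (h : D.weight s k ≠ 0) : 0 < D.lam s k := by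
  refine lt_of_le_of_ne (D.lam_nonneg s k) fun h0 => h ?_
  rw [D.lam_eq, eq_comm, Finset.sum_eq_zero_iff_of_nonneg fun j _ =>
    mul_nonneg (srpow_nonneg (D.q_nonneg j) s) (sq_nonneg _)] at h0
  rw [weight, ← D.f.sum_sq_norm_inner_right]
  refine Finset.sum_eq_zero fun j _ => ?_
  rcases (D.q_nonneg j).eq_or_lt with hj | hj
  · rw [D.inner_f_R_eq_zero hj.symm]
    simp
  · exact (mul_eq_zero.mp (h0 j (Finset.mem_univ j))).resolve_left (srpow_pos hj s).ne'

lemma lam_eq_zero_of_weight_eq_zero {s : ℝ} {k : n} (h : D.weight s k = 0) : D.lam s k = 0 := by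
  have h1 : D.R (D.g s k) = 0 := by
    simpa [weight] using h
  rw [D.lam_eq, h1]
  simp

/-- `tr ρ ln (ρ ^ (1 / 2) σ ^ s ρ ^ (1 / 2)) ≥ tr ρ ln ρ + s tr ρ ln σ`. -/
lemma sum_log_le_sum_weight_log_lam (s : ℝ) :
    ∑ i, D.p i * (Real.log (D.p i) + s * D.L i) ≤ ∑ k, D.weight s k * Real.log (D.lam s k) := by
  have h := sum_log_le_sum_log_of_resolvent (c := D.P)
    (x := fun m => D.p m.1 * srpow s (D.q m.2)) (d := D.weight s) (y := D.lam s)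
    (fun m => mul_nonneg (D.p_nonneg _) (srpow_nonneg (D.q_nonneg _) s)) (D.lam_nonneg s)
    (fun m hm => mul_pos (D.p_pos (D.P_ne_zero hm).1)
      (srpow_q_pos (D.P_ne_zero hm).1 (D.P_ne_zero hm).2 s))
    (fun k hk => D.lam_pos_of_weight_ne_zero hk) (by rw [D.sum_P, D.sum_weight])
    (fun u hu => D.resolvent_le s hu)
  refine le_trans (le_of_eq ?_) h
  rw [Fintype.sum_prod_type]
  refine Finset.sum_congr rfl fun i _ => ?_
  by_cases hi : D.p i = 0
  · simp [hi, P]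
  have e1 : Real.log (D.p i) + s * D.L i
      = ∑ j, D.w i j * (Real.log (D.p i) + Real.log (srpow s (D.q j))) := by
    simp_rw [mul_add]
    rw [Finset.sum_add_distrib, sum_w_log_srpow hi, ← Finset.sum_mul, D.sum_w_right, one_mul]
  rw [e1, Finset.mul_sum]
  refine Finset.sum_congr rfl fun j _ => ?_
  by_cases hj : D.w i j = 0
  · simp [hj, P]
  · rw [Real.log_mul hi (srpow_q_pos hi hj s).ne', P]
    ring

lemma sum_weight_mul_log_le (s : ℝ) :
    ∑ k, D.weight s k * Real.log (D.weight s k) ≤ ∑ i, D.p i * Real.log (D.p i) := by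
  have := D.he.sum_convex_diag_le D.p_nonneg Real.convexOn_mul_log (D.g s)
  simp_rw [← D.weight_eq] at this
  exact this

/-- The exponents of the sandwiched trace in the state `ρ`. -/
def W (α : ℝ) (k : n) : ℝ :=
  α * Real.log (D.lam ((1 - α) / α) k) - Real.log (D.weight ((1 - α) / α) k)

lemma trSandwich_eq_sum_exp_W (α : ℝ) :
    D.trSandwich α = ∑ k, D.weight ((1 - α) / α) k * Real.exp (D.W α k) := by
  refine Finset.sum_congr rfl fun k _ => ?_
  by_cases h : D.weight ((1 - α) / α) k = 0
  · rw [h, D.lam_eq_zero_of_weight_eq_zero h, srpow_zero, zero_mul]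
  · have hw : 0 < D.weight ((1 - α) / α) k := lt_of_le_of_ne (D.weight_nonneg _ _) (Ne.symm h)
    have hl := D.lam_pos_of_weight_ne_zero h
    rw [W, Real.exp_sub, Real.exp_log hw, mul_div_cancel₀ _ h, srpow_of_pos hl,
      Real.rpow_def_of_pos hl, mul_comm]

lemma sum_W_eq (α : ℝ) : ∑ k, D.weight ((1 - α) / α) k * D.W α k
    = α * ∑ k, D.weight ((1 - α) / α) k * Real.log (D.lam ((1 - α) / α) k)
      - ∑ k, D.weight ((1 - α) / α) k * Real.log (D.weight ((1 - α) / α) k) := by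
  rw [Finset.mul_sum, ← Finset.sum_sub_distrib]
  refine Finset.sum_congr rfl fun k _ => ?_
  rw [W]
  ring

lemma mul_sum_log_sub_eq {α : ℝ} (hα : 0 < α) :
    α * ∑ i, D.p i * (Real.log (D.p i) + (1 - α) / α * D.L i) - ∑ i, D.p i * Real.log (D.p i)
      = (α - 1) * relEntropy ρ σ := by
  rw [D.relEntropy_eq_sum_p, Finset.mul_sum, Finset.mul_sum, ← Finset.sum_sub_distrib]
  refine Finset.sum_congr rfl fun i _ => ?_
  field_simp
  ring

/-- The logarithmic inequality bounds the first part of `W`; Peierls for `x log x` bounds the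
entropy part. -/
lemma mul_relEntropy_le_sum_W {α : ℝ} (hα : 0 < α) :
    (α - 1) * relEntropy ρ σ ≤ ∑ k, D.weight ((1 - α) / α) k * D.W α k := by
  rw [D.sum_W_eq, ← D.mul_sum_log_sub_eq hα]
  have h1 := mul_le_mul_of_nonneg_left (D.sum_log_le_sum_weight_log_lam ((1 - α) / α)) hα.le
  have h2 := D.sum_weight_mul_log_le ((1 - α) / α)
  linarith

lemma trSandwich_pos' (α : ℝ) : 0 < D.trSandwich α := by
  rw [D.trSandwich_eq_sum_exp_W]
  exact (Real.exp_pos _).trans_le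
    (exp_sum_le_sum_exp (D.weight_nonneg _) (D.sum_weight _))

/-- Equality of the sandwiched divergence of an order in `(0, 1)` with the relative entropy. -/
lemma condition_of_sandwichedFormula_eq_of_lt_one (D : SpectralPair ρ σ) {α : ℝ} (hα : 0 < α) (hα1 : α < 1)
    (h : sandwichedFormula ρ σ α = relEntropy ρ σ) :
    Commute ρ σ ∧ ∃ c : ℝ, ρ = c • (suppProj ρ * σ) := by
  set s := (1 - α) / α with hs
  have hs0 : 0 < s := div_pos (by linarith) hα
  set S := relEntropy ρ σ with hS
  have htr := D.exp_sandwichedFormula hα1.ne (D.trSandwich_pos' α)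
  rw [h, D.trSandwich_eq_sum_exp_W] at htr
  have hW := D.mul_relEntropy_le_sum_W hα
  have hW' : ∑ k, D.weight s k * D.W α k ≤ (α - 1) * S := by
    rw [← Real.exp_le_exp, htr]
    exact exp_sum_le_sum_exp (D.weight_nonneg _) (D.sum_weight _)
  have hconst : ∀ k, D.weight s k ≠ 0 → D.W α k = (α - 1) * S := fun k hk =>
    (eq_sum_of_sum_exp_le (D.weight_nonneg _) (D.sum_weight _)
      (htr.ge.trans (Real.exp_le_exp.mpr hW)) k hk).trans (le_antisymm hW' hW)
  have hent : ∑ i, D.p i * Real.log (D.p i) ≤ ∑ k, D.weight s k * Real.log (D.weight s k) := by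
    have h1 := mul_le_mul_of_nonneg_left (D.sum_log_le_sum_weight_log_lam s) hα.le
    have h2 := D.mul_sum_log_sub_eq hα
    rw [D.sum_W_eq] at hW'
    linarith
  have hg : IsEigenbasis ρ (D.g s) (D.weight s) := by
    have := D.he.isEigenbasis_of_sum_le D.p_nonneg Real.strictConvexOn_mul_log (D.g s) (by
      simp_rw [← D.weight_eq]
      exact hent)
    simpa only [← D.weight_eq] using this
  -- Equality of the entropies has made `g` an eigenbasis of `ρ`. Replacing `e` by `g` makes `lam` a
  -- diagonal entry, so the Jensen argument for `A` and `L` applies.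
  let D' : SpectralPair ρ σ :=
    { e := D.g s
      f := D.f
      p := D.weight s
      q := D.q
      he := hg
      hf := D.hf
      p_nonneg := D.weight_nonneg s
      q_nonneg := D.q_nonneg
      sum_p := D.sum_weight s
      inner_eq_zero := by
        intro k j hk hj
        have h1 := hg k
        have h2 : (inner ℂ (D.f j) (op ρ (D.g s k)) : ℂ) = 0 := by
          have h3 : op ρ (D.g s k) = D.R (D.R (D.g s k)) := by
            unfold R
            rw [← op_mul, D.he.suppPow_mul_suppPow D.p_nonneg, add_halves, D.he.suppPow_one]
          rw [h3, D.inner_f_R_eq_zero hj]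
        rw [h1, inner_smul_right, mul_eq_zero] at h2
        have h4 := h2.resolve_left (by exact_mod_cast hk)
        rw [← inner_conj_symm, h4, map_zero] }
  have hlam : ∀ k, D.lam s k = D.weight s k * D'.A s k := by
    intro k
    have h1 := D'.re_inner_sandwich_e s k
    have h2 : (inner ℂ (D.g s k) (op (sandwich ρ σ s) (D.g s k)) : ℂ).re = D.lam s k := by
      rw [D.isEigenbasis_g s k, inner_smul_right, inner_self_eq_norm_sq_to_K,
        (D.g s).orthonormal.1 k]
      simp
    rw [← h2]
    exact h1
  have hA : ∀ k, D.weight s k ≠ 0 →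
      Real.log (D'.A s k) = s * (Real.log (D.weight s k) - S) := by
    intro k hk
    have h1 := hconst k hk
    have hAk : 0 < D'.A s k := A_pos (D := D') hk s
    rw [W, hlam, Real.log_mul hk hAk.ne'] at h1
    rw [hs, div_mul_eq_mul_div, eq_div_iff hα.ne']
    linarith
  have hY : ∀ k, D'.p k ≠ 0 → Real.log (D'.p k) - D'.L k = S := by
    intro k hk
    -- For `s > 0` Jensen bounds these values below by their mean, hence the negation.
    have h1 : ∀ k, D'.p k ≠ 0 → -(Real.log (D'.p k) - D'.L k) ≤ -S := by
      intro k hk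
      have h2 := mul_L_le_log_A (D := D') hk s
      rw [hA k hk] at h2
      have h3 := le_of_mul_le_mul_left h2 hs0
      change -(Real.log (D.weight s k) - D'.L k) ≤ -S
      linarith
    have h4 := eq_of_le_of_le_sum D'.p_nonneg D'.sum_p h1 (by
      rw [hS, D'.relEntropy_eq_sum_p, ← Finset.sum_neg_distrib]
      exact Finset.sum_le_sum fun i _ => le_of_eq (by ring)) k hk
    linarith
  refine D'.condition_of_X_eq (D'.X_eq_of_L hs0.ne' hY fun k hk => ?_)
  rw [hA k hk, ← hY k hk]
  refine le_of_eq ?_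
  change s * (Real.log (D.weight s k) - (Real.log (D.weight s k) - D'.L k)) = _
  ring

end SpectralPair

/-! ### The sandwiched limit at order `0`, and the sandwiched quantity under condition 7. -/

/-- The trace of a power with exponent in `(0, 1]` is monotone. -/
lemma trace_suppPow_mono {A B : Matrix n n ℂ} (hA : A.IsHermitian) (hB : B.IsHermitian)
    (h0 : ∀ x, 0 ≤ (inner ℂ x (op A x) : ℂ).re)
    (hAB : ∀ x, (inner ℂ x (op A x) : ℂ).re ≤ (inner ℂ x (op B x) : ℂ).re) {α : ℝ}
    (hα : 0 < α) (hα1 : α ≤ 1) : (suppPow A α).trace.re ≤ (suppPow B α).trace.re := by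
  have hdiag : ∀ {M : Matrix n n ℂ} (hM : M.IsHermitian) (k : n),
      (inner ℂ (hM.eigenvectorBasis k) (op M (hM.eigenvectorBasis k)) : ℂ).re
        = hM.eigenvalues k := by
    intro M hM k
    rw [isEigenbasis_eigenvectorBasis hM k, inner_smul_right, inner_self_eq_norm_sq_to_K,
      hM.eigenvectorBasis.orthonormal.1 k]
    simp
  have hA0 : ∀ k, 0 ≤ hA.eigenvalues k := fun k => by
    rw [← hdiag hA]
    exact h0 _
  rw [((isEigenbasis_eigenvectorBasis hA).suppPow α).trace_re,
    ((isEigenbasis_eigenvectorBasis hB).suppPow α).trace_re]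
  simp_rw [srpow_eq_rpow hα]
  refine ((isEigenbasis_eigenvectorBasis hA).le_sum_concave_diag hA0
    (Real.concaveOn_rpow hα.le hα1) hB.eigenvectorBasis).trans ?_
  refine Finset.sum_le_sum fun k _ => Real.rpow_le_rpow (h0 _) ?_ hα.le
  rw [← hdiag hB]
  exact hAB _

/-- The missing mass is placed at `0`, where the power vanishes. -/
lemma sum_mul_rpow_le {ι : Type*} [Fintype ι] {w b : ι → ℝ} (hw : ∀ i, 0 ≤ w i)
    (h1 : ∑ i, w i ≤ 1) (hb : ∀ i, 0 ≤ b i) {α : ℝ} (hα : 0 < α) (hα1 : α ≤ 1) :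
    ∑ i, w i * b i ^ α ≤ (∑ i, w i * b i) ^ α := by
  have := (Real.concaveOn_rpow hα.le hα1).map_add_sum_le (t := Finset.univ) (w := w) (p := b)
    (v := 1 - ∑ i, w i) (q := 0) (fun i _ => hw i) (by ring) (fun i _ => hb i) (by linarith)
    Set.self_mem_Ici
  simpa [Real.zero_rpow hα.ne'] using this

namespace SpectralPair

variable {ρ σ : Matrix n n ℂ} (D : SpectralPair ρ σ)

lemma trSandwich_eq_trace (α : ℝ) :
    D.trSandwich α = (suppPow (sandwich ρ σ ((1 - α) / α)) α).trace.re :=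
  (((D.isEigenbasis_g _).suppPow α).trace_re).symm

lemma Scale.isEigenbasis_sandwich {D : SpectralPair ρ σ} {c : ℝ} (h : D.Scale c) (s : ℝ) :
    IsEigenbasis (sandwich ρ σ s) D.e (fun i => D.p i * srpow s (D.p i / c)) := by
  intro i
  have hR := D.R_e i
  unfold R at hR
  rw [sandwich, op_mul, op_mul, hR, map_smul, map_smul]
  by_cases hi : D.p i = 0
  · simp [hi]
  · rw [suppPow_eq σ, op_cfc_of_op_eq_smul D.hf.isHermitian _ (h.2 i hi), map_smul, hR, smul_smul,
      smul_smul, ← Complex.ofReal_mul, ← Complex.ofReal_mul, mul_right_comm,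
      Real.mul_self_sqrt (D.p_nonneg i)]

lemma Scale.sandwichedFormula_eq {D : SpectralPair ρ σ} {c : ℝ} (h : D.Scale c) {α : ℝ}
    (hα : 0 < α) (hα1 : α ≠ 1) : sandwichedFormula ρ σ α = Real.log c := by
  have htr : D.trSandwich α = c ^ (α - 1) := by
    rw [D.trSandwich_eq_trace, ((h.isEigenbasis_sandwich _).suppPow α).trace_re]
    calc ∑ i, srpow α (D.p i * srpow ((1 - α) / α) (D.p i / c))
        = ∑ i, D.p i * c ^ (α - 1) := by
          refine Finset.sum_congr rfl fun i _ => ?_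
          by_cases hi : D.p i = 0
          · simp [hi, srpow_zero]
          have hp := D.p_pos hi
          have hpc := div_pos hp h.1
          rw [srpow_of_pos hpc, srpow_of_pos (mul_pos hp (Real.rpow_pos_of_pos hpc _)),
            Real.mul_rpow hp.le (Real.rpow_nonneg hpc.le _), ← Real.rpow_mul hpc.le,
            div_mul_cancel₀ _ hα.ne', Real.div_rpow hp.le h.1.le, ← mul_div_assoc,
            ← Real.rpow_add hp, add_sub_cancel, Real.rpow_one, div_eq_mul_inv,
            ← Real.rpow_neg h.1.le, neg_sub]
      _ = c ^ (α - 1) := by rw [← Finset.sum_mul, D.sum_p, one_mul]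
  rw [D.sandwichedFormula_eq, htr, Real.log_rpow h.1, ← mul_assoc,
    one_div_mul_cancel (sub_ne_zero.mpr hα1), one_mul]

lemma exists_pos_le_p : ∃ c, 0 < c ∧ ∀ i, D.p i ≠ 0 → c ≤ D.p i := by
  obtain ⟨i₀, hi₀⟩ := D.exists_p_ne_zero
  obtain ⟨i, hi, hmin⟩ := (Finset.univ.filter fun i => D.p i ≠ 0).exists_min_image D.p
    ⟨i₀, by simpa using hi₀⟩
  exact ⟨D.p i, D.p_pos (by simpa using hi), fun k hk => hmin k (by simpa using hk)⟩

/-- The quantity `tr Π_ρ σ ^ s`. -/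
def trProj (s : ℝ) : ℝ := ∑ i, if D.p i = 0 then 0 else D.A s i

lemma trProj_one : D.trProj 1 = ∑ m, D.P m * Real.exp (-1 * D.X m) := by
  rw [Fintype.sum_prod_type]
  refine Finset.sum_congr rfl fun i _ => ?_
  split_ifs with hi
  · simp [P, hi]
  · refine Finset.sum_congr rfl fun j _ => ?_
    by_cases hj : D.w i j = 0
    · simp [P, hj]
    · have hp := D.p_pos hi
      have hq := D.q_pos hi hj
      rw [srpow_of_pos hq, Real.rpow_one, P, X, neg_one_mul, neg_sub, Real.exp_sub,
        Real.exp_log hp, Real.exp_log hq]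
      field_simp

lemma continuous_trProj : Continuous D.trProj := by
  refine continuous_finsetSum _ fun i _ => ?_
  split_ifs
  · exact continuous_const
  · exact D.continuous_A i

lemma trProj_pos (s : ℝ) : 0 < D.trProj s := by
  obtain ⟨i, hi⟩ := D.exists_p_ne_zero
  refine Finset.sum_pos' (fun k _ => ?_) ⟨i, Finset.mem_univ i, ?_⟩
  · split_ifs with hk
    · exact le_rfl
    · exact (A_pos hk s).le
  · rw [if_neg hi]
    exact A_pos hi s

/-- A lower bound of the sandwiched trace by that of a multiple of the support projection. -/
lemma rpow_mul_trProj_le {c : ℝ} (hc : 0 < c) (hcp : ∀ i, D.p i ≠ 0 → c ≤ D.p i) {α : ℝ}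
    (hα : 0 < α) (hα1 : α ≤ 1) : c ^ α * D.trProj (1 - α) ≤ D.trSandwich α := by
  set s := (1 - α) / α with hs
  -- Thus `Q` is `√c` times the support projection of `ρ`, and `Q * Q ≤ ρ` as forms by the choice of
  -- `c`.
  set κ : ℝ → ℝ := fun x => if x = 0 then 0 else √c with hκ
  set Q := cfc κ ρ with hQ
  have hQe : IsEigenbasis Q D.e (fun i => κ (D.p i)) := D.he.cfc κ
  have hQh : Q.IsHermitian := isHermitian_cfc _
  have hRR : suppPow ρ (1 / 2) * suppPow ρ (1 / 2) = ρ := by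
    rw [D.he.suppPow_mul_suppPow D.p_nonneg, add_halves, D.he.suppPow_one]
  have hCC : suppPow σ (s / 2) * suppPow σ (s / 2) = suppPow σ s := by
    rw [D.hf.suppPow_mul_suppPow D.q_nonneg, add_halves]
  set K := suppPow σ (s / 2) with hK
  have hKh : K.IsHermitian := isHermitian_suppPow _ _
  have hκ2 : ∀ i, κ (D.p i) * κ (D.p i) = if D.p i = 0 then 0 else c := by
    intro i
    simp only [hκ]
    split_ifs
    · simp
    · exact Real.mul_self_sqrt hc.le
  have hκ0 : ∀ i, 0 ≤ κ (D.p i) * κ (D.p i) := fun i => mul_self_nonneg _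
  have hκp : ∀ i, κ (D.p i) * κ (D.p i) ≤ D.p i := by
    intro i
    rw [hκ2]
    split_ifs with hi
    · exact hi.ge
    · exact hcp i hi
  have hform : ∀ (M : Matrix n n ℂ) x, inner ℂ x (op (K * M * K) x)
      = inner ℂ (op K x) (op M (op K x)) := fun M x => by
    rw [op_mul, op_mul, inner_op_left hKh]
  have hQQ := hQe.mul hQe
  have hmono : (suppPow (K * (Q * Q) * K) α).trace.re ≤ D.trSandwich α := by
    rw [D.trSandwich_eq_trace, ← hs, sandwich, ← hCC,
      ← trace_suppPow_swap hKh (isHermitian_suppPow _ _), hRR]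
    refine trace_suppPow_mono (isHermitian_mul_mul hKh hQQ.isHermitian)
      (isHermitian_mul_mul hKh D.he.isHermitian) (fun x => ?_) (fun x => ?_) hα hα1
    · rw [hform, hQQ.re_inner_op_self]
      exact Finset.sum_nonneg fun i _ => mul_nonneg (hκ0 i) (sq_nonneg _)
    · rw [hform, hform, hQQ.re_inner_op_self, D.he.re_inner_op_self]
      exact Finset.sum_le_sum fun i _ => mul_le_mul_of_nonneg_right (hκp i) (sq_nonneg _)
  refine le_trans ?_ hmono
  rw [trace_suppPow_swap hKh hQh, hCC]
  have hNh : (Q * suppPow σ s * Q).IsHermitian := isHermitian_mul_mul hQh (isHermitian_suppPow _ _)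
  set h := hNh.eigenvectorBasis with hh
  have hN : IsEigenbasis _ h hNh.eigenvalues := isEigenbasis_eigenvectorBasis hNh
  have hlam : ∀ k, hNh.eigenvalues k
      = ∑ j, srpow s (D.q j) * ‖(inner ℂ (D.f j) (op Q (h k)) : ℂ)‖ ^ 2 := by
    intro k
    rw [← (D.hf.suppPow s).re_inner_op_self, inner_op_left hQh, ← op_mul, ← op_mul,
      hN k, inner_smul_right, inner_self_eq_norm_sq_to_K, h.orthonormal.1 k]
    simp
  have hnormQ : ∀ x, ‖op Q x‖ ^ 2 = ∑ i, κ (D.p i) * κ (D.p i)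
      * ‖(inner ℂ (D.e i) x : ℂ)‖ ^ 2 := by
    intro x
    rw [← D.e.sum_sq_norm_inner_right]
    refine Finset.sum_congr rfl fun i _ => ?_
    rw [hQe.inner_basis_op, norm_mul, mul_pow, Complex.norm_real, Real.norm_eq_abs, sq_abs, sq]
  have hnormQ_le : ∀ k, ‖op Q (h k)‖ ^ 2 ≤ c := by
    intro k
    rw [hnormQ]
    calc _ ≤ ∑ i, c * ‖(inner ℂ (D.e i) (h k) : ℂ)‖ ^ 2 := by
          refine Finset.sum_le_sum fun i _ => mul_le_mul_of_nonneg_right ?_ (sq_nonneg _)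
          rw [hκ2]
          split_ifs
          · exact hc.le
          · exact le_rfl
      _ = c := by
          rw [← Finset.mul_sum, D.e.sum_sq_norm_inner_right, h.orthonormal.1 k, one_pow, mul_one]
  -- Dividing by `c` leaves weights of total mass at most one, so concavity of the power applies.
  -- Summed over `k`, they give the diagonal of the support projection in the basis `f`.
  have hterm : ∀ k, c ^ α * ∑ j, ‖(inner ℂ (D.f j) (op Q (h k)) : ℂ)‖ ^ 2 / c
      * srpow s (D.q j) ^ α ≤ hNh.eigenvalues k ^ α := by
    intro k
    have h1 := sum_mul_rpow_le (w := fun j => ‖(inner ℂ (D.f j) (op Q (h k)) : ℂ)‖ ^ 2 / c)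
      (b := fun j => srpow s (D.q j)) (fun j => by positivity)
      (by
        rw [← Finset.sum_div, D.f.sum_sq_norm_inner_right]
        exact (div_le_one hc).mpr (hnormQ_le k))
      (fun j => srpow_nonneg (D.q_nonneg j) s) hα hα1
    have h2 : hNh.eigenvalues k = c * ∑ j, ‖(inner ℂ (D.f j) (op Q (h k)) : ℂ)‖ ^ 2 / c
        * srpow s (D.q j) := by
      rw [hlam, Finset.mul_sum]
      refine Finset.sum_congr rfl fun j _ => ?_
      field_simp
    rw [h2, Real.mul_rpow hc.le (Finset.sum_nonneg fun j _ =>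
      mul_nonneg (by positivity) (srpow_nonneg (D.q_nonneg j) s))]
    exact mul_le_mul_of_nonneg_left h1 (Real.rpow_nonneg hc.le _)
  rw [(hN.suppPow α).trace_re]
  simp_rw [srpow_eq_rpow hα]
  refine le_trans (le_of_eq ?_) (Finset.sum_le_sum fun k _ => hterm k)
  rw [← Finset.mul_sum, Finset.sum_comm]
  congr 1
  have hcol : ∀ j, ∑ k, ‖(inner ℂ (D.f j) (op Q (h k)) : ℂ)‖ ^ 2 / c * srpow s (D.q j) ^ α
      = ∑ i, if D.p i = 0 then 0 else D.w i j * srpow (1 - α) (D.q j) := by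
    intro j
    have h1 : ∑ k, ‖(inner ℂ (D.f j) (op Q (h k)) : ℂ)‖ ^ 2 = ‖op Q (D.f j)‖ ^ 2 := by
      rw [← h.sum_sq_norm_inner_left]
      simp_rw [inner_op_left hQh]
    have h2 : srpow s (D.q j) ^ α = srpow (1 - α) (D.q j) := by
      rcases (D.q_nonneg j).eq_or_lt with h0 | h0
      · rw [← h0, srpow_zero, srpow_zero, Real.zero_rpow hα.ne']
      · rw [srpow_of_pos h0, srpow_of_pos h0, ← Real.rpow_mul h0.le, hs, div_mul_cancel₀ _ hα.ne']
    rw [← Finset.sum_mul, ← Finset.sum_div, h1, hnormQ, h2, Finset.sum_div, Finset.sum_mul]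
    refine Finset.sum_congr rfl fun i _ => ?_
    rw [hκ2]
    split_ifs
    · simp
    · rw [w]
      field_simp
  simp_rw [hcol]
  rw [Finset.sum_comm, trProj]
  refine Finset.sum_congr rfl fun i _ => ?_
  split_ifs
  · simp
  · rfl

/-- The factor `1 / (α - 1)` is negative, so the lower bound on the trace bounds the limit above by
`-ln (trProj 1)`. As `trProj 1 = E exp (-X)`, this is the equality case of Jensen at `s = -1`. -/
lemma X_eq_of_tendsto_zero (h : Tendsto (sandwichedFormula ρ σ) (𝓝[>] 0) (𝓝 (relEntropy ρ σ)))
    (m : n × n) (hm : D.P m ≠ 0) : D.X m = relEntropy ρ σ := by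
  obtain ⟨c, hc, hcp⟩ := D.exists_pos_le_p
  have hcont : ContinuousAt (fun α : ℝ =>
      1 / (α - 1) * (α * Real.log c + Real.log (D.trProj (1 - α)))) 0 := by
    refine ContinuousAt.mul (continuousAt_const.div (by fun_prop) (by norm_num)) ?_
    refine ContinuousAt.add (by fun_prop) (ContinuousAt.log ?_ (D.trProj_pos _).ne')
    exact (D.continuous_trProj.comp (continuous_const.sub continuous_id)).continuousAt
  have ht := hcont.tendsto.mono_left (nhdsWithin_le_nhds (s := Set.Ioi 0))
  have hle := le_of_tendsto_of_tendsto h ht (by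
    filter_upwards [Ioo_mem_nhdsGT (zero_lt_one (α := ℝ))] with α hα
    have h1 := D.rpow_mul_trProj_le hc hcp hα.1 hα.2.le
    have hpos := D.trProj_pos (1 - α)
    have hcα := Real.rpow_pos_of_pos hc α
    have h2 := Real.log_le_log (mul_pos hcα hpos) h1
    rw [Real.log_mul hcα.ne' hpos.ne', Real.log_rpow hc] at h2
    rw [D.sandwichedFormula_eq]
    refine mul_le_mul_of_nonpos_left h2 ?_
    exact one_div_nonpos.mpr (by linarith [hα.2]))
  simp only [zero_sub, zero_mul, zero_add, sub_zero] at hle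
  refine D.X_eq_of_sum_exp_le (s := -1) (by norm_num) ?_ m hm
  rw [← D.trProj_one, ← Real.log_le_iff_le_exp (D.trProj_pos 1)]
  linarith

lemma condition_of_sandwichedEq {α : ℝ≥0∞} (hα : α ≠ 1)
    (h : SandwichedEq ρ σ α (relEntropy ρ σ)) (D : SpectralPair ρ σ) :
    Commute ρ σ ∧ ∃ c : ℝ, ρ = c • (suppProj ρ * σ) := by
  rcases HasValueAtOrder.cases hα h with h | ⟨a, ha, ha1, h⟩ | ⟨a, ha, h⟩ | h
  · exact D.condition_of_X_eq (D.X_eq_of_tendsto_zero h)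
  · exact D.condition_of_sandwichedFormula_eq_of_lt_one ha ha1 h
  · exact D.condition_of_X_eq (D.X_eq_of_sandwichedFormula_eq_of_one_lt ha h)
  · exact D.condition_of_X_eq (D.X_eq_of_tendsto_atTop h)

end SpectralPair

end QRenyi

end

theorem theorem6 {n : Type*} [Fintype n] [DecidableEq n] (ρ σ : Matrix n n ℂ)
    (hρ : QRenyi.IsDensityMatrix ρ) (hσ : σ.PosSemidef)
    (hsupp : QRenyi.supp ρ ≤ QRenyi.supp σ) :
    List.TFAE [
      ∀ α : ℝ≥0∞, QRenyi.RenyiEq ρ σ α (QRenyi.relEntropy ρ σ),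
      ∃ α : ℝ≥0∞, α ≠ 1 ∧ QRenyi.RenyiEq ρ σ α (QRenyi.relEntropy ρ σ),
      QRenyi.DerivTendstoAtOne (QRenyi.renyiFormula ρ σ) 0,
      ∀ α : ℝ≥0∞, QRenyi.SandwichedEq ρ σ α (QRenyi.relEntropy ρ σ),
      ∃ α : ℝ≥0∞, α ≠ 1 ∧ QRenyi.SandwichedEq ρ σ α (QRenyi.relEntropy ρ σ),
      QRenyi.DerivTendstoAtOne (QRenyi.sandwichedFormula ρ σ) 0,
      Commute ρ σ ∧ ∃ c : ℝ, ρ = c • (QRenyi.suppProj ρ * σ)] := by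
  obtain ⟨D⟩ := QRenyi.nonempty_spectralPair hρ hσ hsupp
  tfae_have 1 → 2 := fun h => ⟨0, zero_ne_one, h 0⟩
  tfae_have 2 → 7 := fun ⟨_, hα, h⟩ => D.condition_of_X_eq (D.X_eq_of_renyiEq hα h)
  tfae_have 3 → 7 := fun h => D.condition_of_X_eq (D.X_eq_of_deriv_renyiFormula h)
  tfae_have 4 → 5 := fun h => ⟨0, zero_ne_one, h 0⟩
  tfae_have 5 → 7 := fun ⟨_, hα, h⟩ => QRenyi.SpectralPair.condition_of_sandwichedEq hα h D
  tfae_have 6 → 7 := fun h => D.condition_of_X_eq (D.X_eq_of_deriv_sandwichedFormula h)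
  tfae_have 7 → 1 := by
    intro h
    obtain ⟨c, hc⟩ := D.exists_scale h
    rw [hc.relEntropy_eq]
    exact QRenyi.hasValueAtOrder_of_const fun α _ hα => hc.renyiFormula_eq hα
  tfae_have 7 → 3 := by
    intro h
    obtain ⟨c, hc⟩ := D.exists_scale h
    exact QRenyi.derivTendstoAtOne_of_const fun α _ hα => hc.renyiFormula_eq hα
  tfae_have 7 → 4 := by
    intro h
    obtain ⟨c, hc⟩ := D.exists_scale h
    rw [hc.relEntropy_eq]
    exact QRenyi.hasValueAtOrder_of_const fun α h0 hα => hc.sandwichedFormula_eq h0 hα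
  tfae_have 7 → 6 := by
    intro h
    obtain ⟨c, hc⟩ := D.exists_scale h
    exact QRenyi.derivTendstoAtOne_of_const fun α h0 hα => hc.sandwichedFormula_eq h0 hα
  tfae_finish
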